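/- **Notation.** $\mathbb N=\{1,2,\dots\}$; $c_{00}$ is the space of finitely supported real sequences on $\mathbb N$ with unit vectors $e_n$; $f\in c_{00}$ acts on $x\in c_{00}$ by $f(x)=\sum_i f(i)x(i)$; $Ef$ is the restriction of $f$ to $E\subset\mathbb N$; $\operatorname{ran} f$ is the smallest interval containing $\operatorname{supp} f$; $\|f\|_0=\max_i|f(i)|$. For nonzero $f,g$, $f<g$ means $\max\operatorname{supp} f<\min\operatorname{supp} g$. The Schreier families are $\mathcal S_0=\{\{n\}:n\in\mathbb N\}$, $\mathcal S_1=\{F:\#F\le\min F\}$ and $\mathcal S_{n+1}=\{F_1\cup\dots\cup F_k: F_1<\dots<F_k\in\mathcal S_n,\ k\le\min F_1\}$; $x_1<\dots<x_d$ is $\mathcal S_n$-admissible if $\{\min\operatorname{supp} x_i\}_{i\le d}\in\mathcal S_n$. **Choices.** Let $L_0=\{\ell_k:k\in\mathbb N\}\subset\mathbb N$ with $\ell_1>9$, $\ell_{k+1}>2^{2\ell_k}$ and $\sum_k 2^{-\ell_k}<1/1000$, partitioned into infinite sets $L_1,L_2,L_3$. Let $(x_k)$ be a norm dense sequence in the unit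 sphere of $C[0,1]$, put $\|\sum_k a_ku_k\|_u=\max_F\|\sum_{k\in F}a_kx_k\|$ (maximum over finite sets $F$) for finitely supported $(a_k)$, where $(u_k)$ is the unit vector basis, let $(u_k^*)$ be its biorthogonal functionals, and use $\|\cdot\|_u$ also for the dual norm. Let $\mathcal Q$ be the set of finite sequences $(f_1,\dots,f_m)$, $m\ge1$, of nonzero vectors of $c_{00}$ with rational coordinates and $f_1<\dots<f_m$, and let $\sigma:\mathcal Q\to L_2$ be one-to-one with $\sigma(f_1,\dots,f_m)>2^{1/\|f_m\|_0}\max\operatorname{supp} f_m$. **Norming set.** $W\subset c_{00}$ is the smallest set such that: 1. $\pm e_n\in W$ for all $n$, and $W$ is closed under $f\mapsto -f$, under restriction to intervals, and under rational convex combinations. 2. $W$ contains every $f=2^{-n}\sum_{q=1}^d\alpha_q$, $n\ge1$, where $(\alpha_q)_{q\le d}$ is an $\mathcal S_n$-admissible, very fast growing sequence of $\alpha$-averages in $W$. For an interval $E$, $\pm Ef$ is called a functional of type I$_\alpha$ of weight $n$. 3. The same with $\beta$-averages in place of $\alpha$-averages (type I$_\beta$). 4. $W$ contains $f=\frac12\sum_{q\in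 F}(f_q+g_q)$ for every special sequence $(f_q,g_q)_{q=1}^d$ in $W$ and nonempty $F\subset\{1,\dots,d\}$ with $2\#F\le\min\operatorname{supp} f_{\min F}$. For an interval $E$, $\pm Ef$ is called a functional of type II with set of weights $\{w_q:q\in F,\ \operatorname{ran}(f_q+g_q)\cap E\ne\emptyset\}$. 5. For the same special sequences and sets $F$, and rationals $(\lambda_q)_{q\in F}$ with $\|\sum_{q\in F}\lambda_qu_q^*\|_u\le1$, $W$ contains $f=\frac12\sum_{q\in F}\lambda_q(f_q-g_q)$. For an interval $E$, $\pm Ef$ is called a functional of type II with set of weights $\{w_q:q\in F,\ \operatorname{ran}(f_q-g_q)\cap E\ne\emptyset\}$. Here an $\alpha$-average of size $n\ge1$ is an $\alpha=\frac1n\sum_{j=1}^d f_j\in W$ with $d\le n$ and $f_1<\dots<f_d$ in $W$; a $\beta$-average of size $n$ is a $\beta=\frac1n\sum_{j=1}^df_j\in W$ with $d\le n$ and $f_1,\dots,f_d\in W$ of type II with pairwise disjoint sets of weights. Averages $f_1<f_2<\cdots$ of sizes $s(f_j)$ are very fast growing if $s(f_j)>2^{\max\operatorname{supp} f_{j-1}}$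 and $s(f_j)>s(f_{j-1})$ for $j>1$. A special sequence, with $d\ge1$, consists of $f_1<g_1<f_2<\dots<f_d<g_d$ such that $f_q,g_q$ are of type I$_\alpha$ of the same weight $w_q$, $w_1\in L_1$ and $w_q=\sigma(f_1,g_1,\dots,f_{q-1},g_{q-1})$ for $1<q\le d$. Sizes, weights and sets of weights refer to some representation of the vector. **The space.** $\mathfrak X$ is the completion of $c_{00}$ under $\|x\|=\sup\{f(x):f\in W\}$. **Theorem.** For all such choices, $(e_n)_{n\in\mathbb N}$ is a Schauder basis of $\mathfrak X$ which is shrinking (for every $f\in\mathfrak X^*$, the norm of $f$ restricted to $\overline{\operatorname{span}}\{e_i:i\ge n\}$ tends to $0$ as $n\to\infty$) and boundedly complete ($\sum_i a_ie_i$ converges whenever its partial sums are bounded), and $\mathfrak X$ is reflexive. -/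

import Mathlib

open Filter Topology

noncomputable section

namespace RichSpreading

/-! ### Finitely supported vectors

The natural numbers of the construction start at `1`, so coordinates are indexed by `ℕ+`. -/

/-- The space `c₀₀` of finitely supported real sequences indexed by the positive integers. -/
abbrev C00 : Type := ℕ+ →₀ ℝ

/-- `min supp f` (with the value `1` for `f = 0`, which is never used). -/
def minSupp (f : C00) : ℕ+ :=
  if h : f.support.Nonempty then f.support.min' h else 1

/-- `max supp f` (with the value `1` for `f = 0`, which is never used). -/
def maxSupp (f : C00) : ℕ+ :=
  if h : f.support.Nonempty then f.support.max' h else 1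

/-- `ran f`, the smallest interval of positive integers containing the support of `f`. -/
def ran (f : C00) : Set ℕ+ :=
  {i | ∃ a ∈ f.support, ∃ b ∈ f.support, a ≤ i ∧ i ≤ b}

/-- `f < g`: both vectors are nonzero and `max supp f < min supp g`. -/
def Precedes (f g : C00) : Prop :=
  f ≠ 0 ∧ g ≠ 0 ∧ maxSupp f < minSupp g

/-- `f₁ < f₂ < ⋯ < f_d`, all vectors being nonzero. -/
def Successive {d : ℕ} (f : Fin d → C00) : Prop :=
  (∀ i, f i ≠ 0) ∧ ∀ i j, i < j → Precedes (f i) (f j)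

/-- `E f`, the restriction of `f` to the coordinates in `E`. -/
def restrict (E : Set ℕ+) (f : C00) : C00 :=
  haveI : DecidablePred (· ∈ E) := Classical.decPred _
  f.filter (· ∈ E)

/-- The action `f(x) = ∑ i, f(i) x(i)` of `f ∈ c₀₀`, seen as a functional, on `x ∈ c₀₀`. -/
def pairing (f x : C00) : ℝ := x.sum fun i t => f i * t

/-- `‖f‖₀ = max_i |f(i)|`. -/
def supNorm (f : C00) : ℝ := ⨆ i : ℕ+, |f i|

/-! ### The Schreier families -/

/-- The Schreier families `𝒮₀, 𝒮₁, 𝒮₂, …`. -/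
def schreier : ℕ → Set (Finset ℕ+)
  | 0 => {F | ∃ n, F = {n}}
  | 1 => {F | ∀ m ∈ F, F.card ≤ (m : ℕ)}
  | n + 2 => {F | ∃ (k : ℕ) (A : Fin k → Finset ℕ+),
      F = Finset.univ.biUnion A ∧
      (∀ j, A j ∈ schreier (n + 1) ∧ (A j).Nonempty) ∧
      (∀ i j, i < j → ∀ a ∈ A i, ∀ b ∈ A j, a < b) ∧
      ∀ m ∈ F, k ≤ (m : ℕ)}

/-- `x₁ < ⋯ < x_d` is `𝒮ₙ`-admissible. -/
def Admissible (n : ℕ) {d : ℕ} (x : Fin d → C00) : Prop :=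
  Successive x ∧ Finset.univ.image (fun i => minSupp (x i)) ∈ schreier n

/-! ### The universal unconditional basis of Pełczyński -/

/-- The norm `‖∑ aₖ uₖ‖_u = max_F ‖∑_{k ∈ F} aₖ xₖ‖` on finitely supported sequences; it is enough
to let `F` run over the subsets of the support. -/
def uNorm (x : ℕ → C(unitInterval, ℝ)) (a : ℕ →₀ ℝ) : ℝ :=
  a.support.powerset.sup' ⟨∅, Finset.empty_mem_powerset _⟩ fun F => ‖∑ k ∈ F, a k • x k‖

/-- `‖∑_{q ∈ F} λ_q u_q^*‖_u ≤ 1`, where the `u_q^*` are the biorthogonal functionals of the basis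
`(u_k)` and the norm is the one of the dual space (computed on the dense subspace of finitely
supported sequences). -/
def DualNormLeOne (x : ℕ → C(unitInterval, ℝ)) (F : Finset ℕ) (c : ℕ → ℚ) : Prop :=
  ∀ a : ℕ →₀ ℝ, |∑ q ∈ F, (c q : ℝ) * a q| ≤ uNorm x a

/-! ### The choices entering the construction -/

/-- The set `𝒬` of nonempty finite sequences `f₁ < ⋯ < f_m` of (nonzero) vectors of `c₀₀` with
rational coordinates. -/
def codingDomain : Set (List C00) :=
  {l | l ≠ [] ∧ (∀ f ∈ l, f ≠ 0 ∧ ∀ i, ∃ r : ℚ, f i = r) ∧ l.Pairwise Precedes}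

/-- The free choices in the construction: a fast increasing sequence `L₀ = {ℓ₁ < ℓ₂ < ⋯}` (here
indexed from `0`), a decomposition of `L₀` into infinite sets `L₁, L₂, L₃`, a norm dense sequence in
the unit sphere of `C[0,1]`, and a coding function `σ : 𝒬 → L₂`. -/
structure Choices where
  ell : ℕ → ℕ
  nine_lt_ell : 9 < ell 0
  ell_growth : ∀ k, 2 ^ (2 * ell k) < ell (k + 1)
  ell_sum : Summable (fun k => 1 / (2 : ℝ) ^ ell k) ∧ ∑' k, 1 / (2 : ℝ) ^ ell k < 1 / 1000
  L₁ : Set ℕ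
  L₂ : Set ℕ
  L₃ : Set ℕ
  infinite₁ : L₁.Infinite
  infinite₂ : L₂.Infinite
  infinite₃ : L₃.Infinite
  disjoint₁₂ : Disjoint L₁ L₂
  disjoint₁₃ : Disjoint L₁ L₃
  disjoint₂₃ : Disjoint L₂ L₃
  union_eq : L₁ ∪ L₂ ∪ L₃ = Set.range ell
  x : ℕ → C(unitInterval, ℝ)
  norm_x : ∀ k, ‖x k‖ = 1
  dense_x : Metric.sphere (0 : C(unitInterval, ℝ)) 1 ⊆ closure (Set.range x)
  σ : codingDomain → ℕ
  σ_mem : ∀ l, σ l ∈ L₂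
  σ_injective : Function.Injective σ
  σ_growth : ∀ l : codingDomain,
    (2 : ℝ) ^ (1 / supNorm (l.1.getLast l.2.1)) * (maxSupp (l.1.getLast l.2.1) : ℝ) < (σ l : ℝ)

/-! ### The types of functionals, relative to a set `G ⊆ c₀₀`

As one vector may have several representations, sizes and weights are treated as attributes of a
representation: a statement about "a functional of weight `n`" refers to some representation with
that weight. -/

/-- `f` is an α-average of size `n` in `G`. -/
def IsAlphaAverage (G : Set C00) (n : ℕ) (f : C00) : Prop :=
  f ∈ G ∧ 1 ≤ n ∧ ∃ (d : ℕ) (h : Fin d → C00), d ≤ n ∧ (∀ j, h j ∈ G) ∧ Successive h ∧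
    f = (1 / (n : ℝ)) • ∑ j, h j

/-- The sequence `f₁ < ⋯ < f_d` with sizes `s₁, …, s_d` is very fast growing. -/
def VeryFastGrowing {d : ℕ} (f : Fin d → C00) (s : Fin d → ℕ) : Prop :=
  Successive f ∧ ∀ i j : Fin d, (i : ℕ) + 1 = j → 2 ^ (maxSupp (f i) : ℕ) < s j ∧ s i < s j

/-- `g` is a functional of type I, built on the averages described by `Avg`, of weight `n ≥ 1`:
`g = ± E (2⁻ⁿ ∑ α_q)` with `(α_q)` an `𝒮ₙ`-admissible and very fast growing sequence of averages
and `E` an interval. -/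
def IsTypeI (Avg : ℕ → C00 → Prop) (n : ℕ) (g : C00) : Prop :=
  1 ≤ n ∧ ∃ (d : ℕ) (α : Fin d → C00) (s : Fin d → ℕ) (E : Set ℕ+) (ε : ℤˣ),
    (∀ q, Avg (s q) (α q)) ∧ Admissible n α ∧ VeryFastGrowing α s ∧ E.OrdConnected ∧
    g = ((ε : ℤ) : ℝ) • restrict E ((1 / (2 : ℝ) ^ n) • ∑ q, α q)

/-- `g` is a functional of type I_α of weight `n`, with averages in `G`. -/
def IsTypeIAlpha (G : Set C00) : ℕ → C00 → Prop := IsTypeI (IsAlphaAverage G)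

/-- The sequence `(f₁, g₁, f₂, g₂, …, f_q, g_q)` (indices shifted to start at `0`). -/
def codeList (f g : ℕ → C00) (q : ℕ) : List C00 :=
  (List.range q).flatMap fun i => [f i, g i]

/-- `{f_q, g_q}_{q=1}^d` is a special sequence in `G`, with weights `w(f_q) = w(g_q) = w_q`
(indices shifted to start at `0`; values at indices `≥ d` are irrelevant). -/
structure IsSpecial (P : Choices) (G : Set C00) (d : ℕ) (f g : ℕ → C00) (w : ℕ → ℕ) : Prop where
  pos : 0 < d
  mem_f : ∀ q < d, f q ∈ G
  mem_g : ∀ q < d, g q ∈ G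
  type_f : ∀ q < d, IsTypeIAlpha G (w q) (f q)
  type_g : ∀ q < d, IsTypeIAlpha G (w q) (g q)
  lt_pair : ∀ q < d, Precedes (f q) (g q)
  lt_next : ∀ q, q + 1 < d → Precedes (g q) (f (q + 1))
  first : w 0 ∈ P.L₁
  coding : ∀ q, 0 < q → q < d →
    ∃ h : codeList f g q ∈ codingDomain, P.σ ⟨codeList f g q, h⟩ = w q

/-- `h` is a functional of type II₊ with set of weights `S`. -/
def IsTypeIIPlus (P : Choices) (G : Set C00) (S : Set ℕ) (h : C00) : Prop :=
  ∃ (d : ℕ) (f g : ℕ → C00) (w : ℕ → ℕ) (F : Finset ℕ) (hF : F.Nonempty) (E : Set ℕ+) (ε : ℤˣ),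
    IsSpecial P G d f g w ∧ F ⊆ Finset.range d ∧
    2 * F.card ≤ (minSupp (f (F.min' hF)) : ℕ) ∧ E.OrdConnected ∧
    h = ((ε : ℤ) : ℝ) • restrict E ((1 / 2 : ℝ) • ∑ q ∈ F, (f q + g q)) ∧
    S = {m | ∃ q ∈ F, m = w q ∧ (ran (f q + g q) ∩ E).Nonempty}

/-- `h` is a functional of type II₋ with set of weights `S`. -/
def IsTypeIIMinus (P : Choices) (G : Set C00) (S : Set ℕ) (h : C00) : Prop :=
  ∃ (d : ℕ) (f g : ℕ → C00) (w : ℕ → ℕ) (F : Finset ℕ) (hF : F.Nonempty) (c : ℕ → ℚ)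
    (E : Set ℕ+) (ε : ℤˣ),
    IsSpecial P G d f g w ∧ F ⊆ Finset.range d ∧
    2 * F.card ≤ (minSupp (f (F.min' hF)) : ℕ) ∧ DualNormLeOne P.x F c ∧ E.OrdConnected ∧
    h = ((ε : ℤ) : ℝ) • restrict E ((1 / 2 : ℝ) • ∑ q ∈ F, (c q : ℝ) • (f q - g q)) ∧
    S = {m | ∃ q ∈ F, m = w q ∧ (ran (f q - g q) ∩ E).Nonempty}

/-- `h` is a functional of type II with set of weights `S`. -/
def IsTypeII (P : Choices) (G : Set C00) (S : Set ℕ) (h : C00) : Prop :=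
  IsTypeIIPlus P G S h ∨ IsTypeIIMinus P G S h

/-- `f` is a β-average of size `n` in `G`. -/
def IsBetaAverage (P : Choices) (G : Set C00) (n : ℕ) (f : C00) : Prop :=
  f ∈ G ∧ 1 ≤ n ∧ ∃ (d : ℕ) (h : Fin d → C00) (S : Fin d → Set ℕ), d ≤ n ∧
    (∀ j, h j ∈ G ∧ IsTypeII P G (S j) (h j)) ∧ Pairwise (fun i j => Disjoint (S i) (S j)) ∧
    f = (1 / (n : ℝ)) • ∑ j, h j

/-- `g` is a functional of type I_β of weight `n`, with averages in `G`. -/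
def IsTypeIBeta (P : Choices) (G : Set C00) : ℕ → C00 → Prop := IsTypeI (IsBetaAverage P G)

/-! ### The norming set -/

/-- The closure properties defining the norming set. As `G` is stable under signs and restrictions
to intervals, membership of all functionals of a given type is the same as membership of the
unrestricted ones. -/
structure IsNormingClosed (P : Choices) (G : Set C00) : Prop where
  basis : ∀ n : ℕ+, Finsupp.single n 1 ∈ G ∧ -Finsupp.single n 1 ∈ G
  neg : ∀ f ∈ G, -f ∈ G
  restrict : ∀ f ∈ G, ∀ E : Set ℕ+, E.OrdConnected → restrict E f ∈ G
  convex : ∀ (n : ℕ) (c : Fin n → ℚ) (f : Fin n → C00), (∀ i, 0 ≤ c i) → ∑ i, c i = 1 →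
    (∀ i, f i ∈ G) → ∑ i, (c i : ℝ) • f i ∈ G
  alpha : ∀ n f, IsTypeIAlpha G n f → f ∈ G
  beta : ∀ n f, IsTypeIBeta P G n f → f ∈ G
  plus : ∀ S f, IsTypeIIPlus P G S f → f ∈ G
  minus : ∀ S f, IsTypeIIMinus P G S f → f ∈ G

/-- The norming set `W`: the smallest subset of `c₀₀` with the closure properties above (see
`normingSet_isNormingClosed`). -/
def normingSet (P : Choices) : Set C00 := ⋂₀ {G | IsNormingClosed P G}

theorem normingSet_subset {P : Choices} {G : Set C00} (h : IsNormingClosed P G) :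
    normingSet P ⊆ G := Set.sInter_subset_of_mem h

theorem IsAlphaAverage.mono {G H : Set C00} (hGH : G ⊆ H) {n : ℕ} {f : C00}
    (h : IsAlphaAverage G n f) : IsAlphaAverage H n f := by
  obtain ⟨h1, h2, d, k, h3, h4, h5⟩ := h
  exact ⟨hGH h1, h2, d, k, h3, fun j => hGH (h4 j), h5⟩

theorem IsTypeI.mono {A B : ℕ → C00 → Prop} (hAB : ∀ n f, A n f → B n f) {n : ℕ} {f : C00}
    (h : IsTypeI A n f) : IsTypeI B n f := by
  obtain ⟨h1, d, α, s, E, ε, h2, h3⟩ := h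
  exact ⟨h1, d, α, s, E, ε, fun q => hAB _ _ (h2 q), h3⟩

theorem IsTypeIAlpha.mono {G H : Set C00} (hGH : G ⊆ H) {n : ℕ} {f : C00}
    (h : IsTypeIAlpha G n f) : IsTypeIAlpha H n f :=
  IsTypeI.mono (fun _ _ => IsAlphaAverage.mono hGH) h

theorem IsSpecial.mono {P : Choices} {G H : Set C00} (hGH : G ⊆ H) {d : ℕ} {f g : ℕ → C00}
    {w : ℕ → ℕ} (h : IsSpecial P G d f g w) : IsSpecial P H d f g w :=
  ⟨h.pos, fun q hq => hGH (h.mem_f q hq), fun q hq => hGH (h.mem_g q hq),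
    fun q hq => (h.type_f q hq).mono hGH, fun q hq => (h.type_g q hq).mono hGH,
    h.lt_pair, h.lt_next, h.first, h.coding⟩

theorem IsTypeIIPlus.mono {P : Choices} {G H : Set C00} (hGH : G ⊆ H) {S : Set ℕ} {h : C00}
    (hh : IsTypeIIPlus P G S h) : IsTypeIIPlus P H S h := by
  obtain ⟨d, f, g, w, F, hF, E, ε, h1, h2⟩ := hh
  exact ⟨d, f, g, w, F, hF, E, ε, h1.mono hGH, h2⟩

theorem IsTypeIIMinus.mono {P : Choices} {G H : Set C00} (hGH : G ⊆ H) {S : Set ℕ} {h : C00}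
    (hh : IsTypeIIMinus P G S h) : IsTypeIIMinus P H S h := by
  obtain ⟨d, f, g, w, F, hF, c, E, ε, h1, h2⟩ := hh
  exact ⟨d, f, g, w, F, hF, c, E, ε, h1.mono hGH, h2⟩

theorem IsBetaAverage.mono {P : Choices} {G H : Set C00} (hGH : G ⊆ H) {n : ℕ} {f : C00}
    (h : IsBetaAverage P G n f) : IsBetaAverage P H n f := by
  obtain ⟨h1, h2, d, k, S, h3, h4, h5⟩ := h
  exact ⟨hGH h1, h2, d, k, S, h3,
    fun j => ⟨hGH (h4 j).1, (h4 j).2.imp (·.mono hGH) (·.mono hGH)⟩, h5⟩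

theorem IsTypeIBeta.mono {P : Choices} {G H : Set C00} (hGH : G ⊆ H) {n : ℕ} {f : C00}
    (h : IsTypeIBeta P G n f) : IsTypeIBeta P H n f :=
  IsTypeI.mono (fun _ _ => IsBetaAverage.mono hGH) h

theorem normingSet_isNormingClosed (P : Choices) : IsNormingClosed P (normingSet P) where
  basis n := ⟨fun _ hG => (hG.basis n).1, fun _ hG => (hG.basis n).2⟩
  neg f hf _ hG := hG.neg f (hf _ hG)
  restrict f hf E hE G hG := hG.restrict f (hf G hG) E hE
  convex n c f h0 h1 hf G hG := hG.convex n c f h0 h1 fun i => hf i G hG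
  alpha n f hf _ hG := hG.alpha n f (hf.mono (normingSet_subset hG))
  beta n f hf _ hG := hG.beta n f (hf.mono (normingSet_subset hG))
  plus S f hf _ hG := hG.plus S f (hf.mono (normingSet_subset hG))
  minus S f hf _ hG := hG.minus S f (hf.mono (normingSet_subset hG))

/-! ### Functionals in the norming set have coordinates in `[-1, 1]` -/

theorem restrict_apply_abs_le (E : Set ℕ+) (f : C00) (i : ℕ+) : |restrict E f i| ≤ |f i| := by
  classical
  unfold restrict
  rw [Finsupp.filter_apply]
  split_ifs <;> simp

theorem le_of_mem_support {f : C00} {i : ℕ+} (h : f i ≠ 0) : minSupp f ≤ i ∧ i ≤ maxSupp f := by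
  have hi : i ∈ f.support := Finsupp.mem_support_iff.2 h
  have hne : f.support.Nonempty := ⟨i, hi⟩
  unfold minSupp maxSupp
  rw [dif_pos hne, dif_pos hne]
  exact ⟨Finset.min'_le _ _ hi, Finset.le_max' _ _ hi⟩

theorem Precedes.disjoint {f g : C00} (h : Precedes f g) (i : ℕ+) : f i = 0 ∨ g i = 0 := by
  by_contra! hc
  exact absurd ((le_of_mem_support hc.2).1.trans (le_of_mem_support hc.1).2) (not_le.2 h.2.2)

theorem abs_sum_le_of_disjoint {ι : Type*} (s : Finset ι) (a : ι → ℝ) (C : ℝ) (hC : 0 ≤ C)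
    (ha : ∀ i ∈ s, |a i| ≤ C) (hd : ∀ i ∈ s, ∀ j ∈ s, i ≠ j → a i = 0 ∨ a j = 0) :
    |∑ i ∈ s, a i| ≤ C := by
  by_cases h : ∃ i ∈ s, a i ≠ 0
  · obtain ⟨i, hi, hne⟩ := h
    rw [Finset.sum_eq_single_of_mem i hi fun j hj hji => (hd i hi j hj hji.symm).resolve_left hne]
    exact ha i hi
  · push Not at h
    rw [Finset.sum_eq_zero h]
    simpa using hC

theorem abs_average_le {n d : ℕ} (hn : 1 ≤ n) (hd : d ≤ n) (h : Fin d → C00)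
    (hh : ∀ j i, |h j i| ≤ 1) (i : ℕ+) : |((1 / (n : ℝ)) • ∑ j, h j) i| ≤ 1 := by
  have hn' : (0 : ℝ) < n := by exact_mod_cast hn
  rw [Finsupp.smul_apply, smul_eq_mul, abs_mul, Finsupp.finsetSum_apply,
    abs_of_pos (by positivity), one_div, inv_mul_le_iff₀ hn', mul_one]
  calc |∑ j, h j i| ≤ ∑ j : Fin d, |h j i| := Finset.abs_sum_le_sum_abs _ _
    _ ≤ ∑ j : Fin d, (1 : ℝ) := Finset.sum_le_sum fun j _ => hh j i
    _ = d := by simp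
    _ ≤ n := by exact_mod_cast hd

theorem abs_sign_restrict_le (ε : ℤˣ) (E : Set ℕ+) (f : C00) (i : ℕ+) :
    |(((ε : ℤ) : ℝ) • restrict E f) i| ≤ |f i| := by
  rw [Finsupp.smul_apply, smul_eq_mul, abs_mul]
  rcases Int.units_eq_one_or ε with rfl | rfl <;> simpa using restrict_apply_abs_le E f i

theorem IsTypeI.abs_le {A : ℕ → C00 → Prop} (hA : ∀ n f, A n f → ∀ i, |f i| ≤ 1) {n : ℕ} {g : C00}
    (h : IsTypeI A n g) (i : ℕ+) : |g i| ≤ 1 := by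
  obtain ⟨-, d, α, s, E, ε, h1, h2, -, -, rfl⟩ := h
  refine (abs_sign_restrict_le ε E _ i).trans ?_
  rw [Finsupp.smul_apply, smul_eq_mul, abs_mul, Finsupp.finsetSum_apply]
  have h3 : |∑ q, α q i| ≤ 1 := by
    refine abs_sum_le_of_disjoint _ _ 1 zero_le_one (fun q _ => hA _ _ (h1 q) i) ?_
    intro p _ q _ hpq
    rcases lt_or_gt_of_ne hpq with hlt | hlt
    · exact (h2.1.2 p q hlt).disjoint i
    · exact ((h2.1.2 q p hlt).disjoint i).symm
  have h4 : |1 / (2 : ℝ) ^ n| ≤ 1 := by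
    rw [abs_of_pos (by positivity), div_le_one (by positivity)]
    exact one_le_pow₀ (by norm_num)
  exact mul_le_one₀ h4 (abs_nonneg _) h3

theorem IsSpecial.lt_of_lt {P : Choices} {G : Set C00} {d : ℕ} {f g : ℕ → C00} {w : ℕ → ℕ}
    (h : IsSpecial P G d f g w) {p q : ℕ} (hpq : p < q) (hq : q < d) :
    maxSupp (g p) < minSupp (f q) := by
  have key : ∀ u : C00, u ≠ 0 → minSupp u ≤ maxSupp u := fun u hu => by
    obtain ⟨i, hi⟩ := Finsupp.ne_iff.1 hu
    exact (le_of_mem_support hi).1.trans (le_of_mem_support hi).2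
  induction q, hpq using Nat.le_induction with
  | base => exact (h.lt_next p hq).2.2
  | succ q hle ih =>
    have h1 := ih (by omega)
    have h2 := h.lt_pair q (by omega)
    have h3 := h.lt_next q hq
    exact h1.trans_le ((key _ h2.1).trans (h2.2.2.le.trans ((key _ h2.2.1).trans h3.2.2.le)))

theorem IsSpecial.disjoint_pair {P : Choices} {G : Set C00} {d : ℕ} {f g : ℕ → C00} {w : ℕ → ℕ}
    (h : IsSpecial P G d f g w) (i : ℕ+) {p q : ℕ} (hpq : p < q) (hq : q < d) :
    (f p i = 0 ∧ g p i = 0) ∨ (f q i = 0 ∧ g q i = 0) := by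
  have h1 := h.lt_of_lt hpq hq
  have h2 := (h.lt_pair p (hpq.trans hq)).2.2
  have h3 := (h.lt_pair q hq).2.2
  have key : ∀ u : C00, u ≠ 0 → minSupp u ≤ maxSupp u := fun u hu => by
    obtain ⟨i, hi⟩ := Finsupp.ne_iff.1 hu
    exact (le_of_mem_support hi).1.trans (le_of_mem_support hi).2
  have h4 := key _ (h.lt_pair p (hpq.trans hq)).2.1
  have h5 := key _ (h.lt_pair q hq).1
  rcases le_or_gt i (maxSupp (g p)) with hi | hi
  · right
    constructor <;> by_contra hc
    · exact absurd ((le_of_mem_support hc).1.trans hi) (not_le.2 h1)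
    · exact absurd ((le_of_mem_support hc).1.trans hi) (not_le.2 (h1.trans_le (h5.trans h3.le)))
  · left
    constructor <;> by_contra hc
    · exact absurd (hi.trans_le (le_of_mem_support hc).2) (not_lt.2 (h2.le.trans h4))
    · exact absurd (hi.trans_le (le_of_mem_support hc).2) (lt_irrefl _)

theorem IsSpecial.abs_sum_le {P : Choices} {G : Set C00} {d : ℕ} {f g : ℕ → C00} {w : ℕ → ℕ}
    (h : IsSpecial P G d f g w) (hG : ∀ u ∈ G, ∀ i, |u i| ≤ 1) {F : Finset ℕ}
    (hF : F ⊆ Finset.range d) (a b : ℕ → ℝ) (ha : ∀ q ∈ F, |a q| ≤ 1) (hb : ∀ q ∈ F, |b q| ≤ 1)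
    (i : ℕ+) : |((1 / 2 : ℝ) • ∑ q ∈ F, (a q • f q + b q • g q)) i| ≤ 1 := by
  have hlt : ∀ q ∈ F, q < d := fun q hq => Finset.mem_range.1 (hF hq)
  have h3 : |∑ q ∈ F, (a q * f q i + b q * g q i)| ≤ 1 := by
    refine abs_sum_le_of_disjoint _ _ 1 zero_le_one (fun q hq => ?_) fun p hp q hq hpq => ?_
    · rcases (h.lt_pair q (hlt q hq)).disjoint i with h0 | h0
      · rw [h0, mul_zero, zero_add, abs_mul]
        exact mul_le_one₀ (hb q hq) (abs_nonneg _) (hG _ (h.mem_g q (hlt q hq)) i)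
      · rw [h0, mul_zero, add_zero, abs_mul]
        exact mul_le_one₀ (ha q hq) (abs_nonneg _) (hG _ (h.mem_f q (hlt q hq)) i)
    · rcases lt_or_gt_of_ne hpq with hlt' | hlt'
      · rcases h.disjoint_pair i hlt' (hlt q hq) with h0 | h0 <;> simp [h0.1, h0.2]
      · rcases h.disjoint_pair i hlt' (hlt p hp) with h0 | h0 <;> simp [h0.1, h0.2]
  rw [Finsupp.smul_apply, smul_eq_mul, abs_mul, Finsupp.finsetSum_apply]
  refine mul_le_one₀ (by norm_num [abs_of_pos]) (abs_nonneg _) ?_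
  simpa using h3

theorem DualNormLeOne.abs_le {x : ℕ → C(unitInterval, ℝ)} (hx : ∀ k, ‖x k‖ = 1) {F : Finset ℕ}
    {c : ℕ → ℚ} (h : DualNormLeOne x F c) {q : ℕ} (hq : q ∈ F) : |(c q : ℝ)| ≤ 1 := by
  classical
  have h1 := h (Finsupp.single q 1)
  have h2 : ∑ p ∈ F, (c p : ℝ) * (Finsupp.single q (1 : ℝ)) p = c q := by
    rw [Finset.sum_eq_single_of_mem q hq fun p _ hp => by simp [hp.symm]]
    simp
  rw [h2] at h1
  refine h1.trans ?_
  unfold uNorm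
  refine Finset.sup'_le _ _ fun A hA => ?_
  have hA' : A ⊆ {q} := (Finset.mem_powerset.1 hA).trans Finsupp.support_single_subset
  rcases Finset.subset_singleton_iff.1 hA' with rfl | rfl <;> simp [hx]

theorem isNormingClosed_unit (P : Choices) : IsNormingClosed P {f | ∀ i, |f i| ≤ 1} where
  basis n := by
    classical
    constructor <;> intro i <;>
      simp only [Finsupp.neg_apply, abs_neg, Finsupp.single_apply] <;> split_ifs <;> simp
  neg f hf i := by simpa using hf i
  restrict f hf E _ i := (restrict_apply_abs_le E f i).trans (hf i)
  convex n c f h0 h1 hf i := by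
    rw [Finsupp.finsetSum_apply]
    calc |∑ j, ((c j : ℝ) • f j) i| ≤ ∑ j, |((c j : ℝ) • f j) i| := Finset.abs_sum_le_sum_abs _ _
      _ ≤ ∑ j, (c j : ℝ) := Finset.sum_le_sum fun j _ => by
        have hc : (0 : ℝ) ≤ c j := by exact_mod_cast h0 j
        rw [Finsupp.smul_apply, smul_eq_mul, abs_mul, abs_of_nonneg hc]
        exact mul_le_of_le_one_right hc (hf j i)
      _ = 1 := by exact_mod_cast h1
  alpha n f hf := IsTypeI.abs_le (fun _ _ h => h.1) hf
  beta n f hf := IsTypeI.abs_le (fun _ _ h => h.1) hf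
  plus S u hu i := by
    obtain ⟨d, f, g, w, F, hF, E, ε, h1, h2, -, -, rfl, -⟩ := hu
    refine (abs_sign_restrict_le ε E _ i).trans ?_
    simpa using h1.abs_sum_le (fun _ h => h) h2 (fun _ => 1) (fun _ => 1) (by simp) (by simp) i
  minus S u hu i := by
    obtain ⟨d, f, g, w, F, hF, c, E, ε, h1, h2, -, h3, -, rfl, -⟩ := hu
    refine (abs_sign_restrict_le ε E _ i).trans ?_
    have h4 := h1.abs_sum_le (fun _ h => h) h2 (fun q => (c q : ℝ)) (fun q => -(c q : ℝ))
      (fun q hq => h3.abs_le P.norm_x hq) (fun q hq => by simpa using h3.abs_le P.norm_x hq) i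
    simpa [smul_sub, sub_eq_add_neg] using h4

theorem abs_le_one_of_mem {P : Choices} {f : C00} (hf : f ∈ normingSet P) (i : ℕ+) : |f i| ≤ 1 :=
  normingSet_subset (isNormingClosed_unit P) hf i

/-! ### The space `𝔛` -/

/-- `c₀₀`, to be equipped with the norm `‖x‖ = sup {f(x) : f ∈ W}`. -/
def PreX (_P : Choices) : Type := C00

instance (P : Choices) : AddCommGroup (PreX P) := inferInstanceAs (AddCommGroup C00)

instance (P : Choices) : Module ℝ (PreX P) := inferInstanceAs (Module ℝ C00)

/-- The underlying finitely supported sequence of an element of `PreX P`. -/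
def toC00 (P : Choices) : PreX P ≃ₗ[ℝ] C00 := LinearEquiv.refl ℝ C00

instance (P : Choices) : Norm (PreX P) :=
  ⟨fun x => sSup ((fun f => pairing f (toC00 P x)) '' normingSet P)⟩

theorem norm_def {P : Choices} (x : PreX P) :
    ‖x‖ = sSup ((fun f => pairing f (toC00 P x)) '' normingSet P) := rfl

theorem pairing_add (f x y : C00) : pairing f (x + y) = pairing f x + pairing f y :=
  Finsupp.sum_add_index' (by simp) (by intros; ring)

theorem pairing_smul (f : C00) (r : ℝ) (x : C00) : pairing f (r • x) = r * pairing f x := by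
  unfold pairing
  rw [Finsupp.sum_smul_index (by simp), Finsupp.mul_sum]
  exact Finsupp.sum_congr fun _ _ => by ring

theorem pairing_neg_left (f x : C00) : pairing (-f) x = -pairing f x := by
  simp [pairing, Finsupp.sum]

theorem pairing_single (n : ℕ+) (x : C00) : pairing (Finsupp.single n 1) x = x n := by
  classical
  simp only [pairing, Finsupp.sum, Finsupp.single_apply, ite_mul, one_mul, zero_mul,
    Finset.sum_ite_eq]
  split_ifs with h
  · rfl
  · exact (Finsupp.notMem_support_iff.1 h).symm

theorem bddAbove_pairing (P : Choices) (x : C00) :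
    BddAbove ((fun f => pairing f x) '' normingSet P) := by
  refine ⟨x.sum fun _ t => |t|, ?_⟩
  rintro _ ⟨f, hf, rfl⟩
  refine Finset.sum_le_sum fun i _ => (le_abs_self _).trans ?_
  rw [abs_mul]
  exact mul_le_of_le_one_left (abs_nonneg _) (abs_le_one_of_mem hf i)

theorem pairing_le_norm {P : Choices} {f : C00} (hf : f ∈ normingSet P) (x : PreX P) :
    pairing f (toC00 P x) ≤ ‖x‖ := le_csSup (bddAbove_pairing P _) ⟨f, hf, rfl⟩

theorem abs_pairing_le_norm {P : Choices} {f : C00} (hf : f ∈ normingSet P) (x : PreX P) :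
    |pairing f (toC00 P x)| ≤ ‖x‖ := by
  refine abs_le'.2 ⟨pairing_le_norm hf x, ?_⟩
  rw [← pairing_neg_left]
  exact pairing_le_norm ((normingSet_isNormingClosed P).neg f hf) x

theorem norm_le_of_forall {P : Choices} {x : PreX P} {C : ℝ}
    (h : ∀ f ∈ normingSet P, pairing f (toC00 P x) ≤ C) : ‖x‖ ≤ C := by
  refine csSup_le ⟨_, Finsupp.single 1 1, ((normingSet_isNormingClosed P).basis 1).1, rfl⟩ ?_
  rintro _ ⟨f, hf, rfl⟩
  exact h f hf

theorem preX_norm_nonneg {P : Choices} (x : PreX P) : 0 ≤ ‖x‖ :=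
  (abs_nonneg _).trans (abs_pairing_le_norm ((normingSet_isNormingClosed P).basis 1).1 x)

theorem preX_norm_smul_le {P : Choices} (r : ℝ) (x : PreX P) : ‖r • x‖ ≤ ‖r‖ * ‖x‖ :=
  norm_le_of_forall fun f hf => by
    rw [map_smul, pairing_smul]
    refine (le_abs_self _).trans ?_
    rw [abs_mul, Real.norm_eq_abs]
    exact mul_le_mul_of_nonneg_left (abs_pairing_le_norm hf x) (abs_nonneg r)

theorem preX_core (P : Choices) : NormedSpace.Core ℝ (PreX P) where
  norm_nonneg := preX_norm_nonneg
  norm_smul r x := by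
    refine le_antisymm (preX_norm_smul_le r x) ?_
    rcases eq_or_ne r 0 with rfl | hr
    · simpa using preX_norm_nonneg ((0 : ℝ) • x)
    · have h := preX_norm_smul_le r⁻¹ (r • x)
      rw [smul_smul, inv_mul_cancel₀ hr, one_smul, norm_inv] at h
      rwa [← le_inv_mul_iff₀ (norm_pos_iff.2 hr)]
  norm_triangle x y := norm_le_of_forall fun f hf => by
    rw [map_add, pairing_add]
    exact add_le_add (pairing_le_norm hf x) (pairing_le_norm hf y)
  norm_eq_zero_iff x := by
    constructor
    · intro h
      refine (toC00 P).map_eq_zero_iff.1 (Finsupp.ext fun i => ?_)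
      have h1 := abs_pairing_le_norm ((normingSet_isNormingClosed P).basis i).1 x
      rw [h, pairing_single] at h1
      simpa using h1
    · rintro rfl
      refine le_antisymm (norm_le_of_forall fun f _ => ?_) (preX_norm_nonneg _)
      rw [map_zero]
      exact le_of_eq (Finsupp.sum_zero_index (h := fun i t => f i * t))

instance (P : Choices) : NormedAddCommGroup (PreX P) := NormedAddCommGroup.ofCore (preX_core P)

instance (P : Choices) : NormedSpace ℝ (PreX P) := NormedSpace.ofCore (preX_core P)

/-- The Banach space `𝔛`, the completion of `(c₀₀, ‖·‖)`. -/
abbrev X (P : Choices) : Type := UniformSpace.Completion (PreX P)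

/-- The unit vector `e_n` in `𝔛`, for `n = 1, 2, …`. -/
def e (P : Choices) (n : ℕ+) : X P :=
  (((toC00 P).symm (Finsupp.single n 1) : PreX P) : X P)

/-! ### Shrinking and boundedly complete bases, reflexivity -/

/-- A Schauder basis is shrinking if the restrictions of every bounded functional to the closed
linear spans of the tails of the basis tend to `0` in norm. -/
def IsShrinking {E : Type*} [NormedAddCommGroup E] [NormedSpace ℝ E] (b : SchauderBasis ℝ E) :
    Prop :=
  ∀ f : StrongDual ℝ E, Tendsto
    (fun n : ℕ => ‖f.comp (Submodule.span ℝ (b '' Set.Ici n)).topologicalClosure.subtypeL‖)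
    atTop (𝓝 0)

/-- A Schauder basis is boundedly complete if `∑ aᵢ bᵢ` converges whenever its partial sums are
bounded. -/
def IsBoundedlyComplete {E : Type*} [NormedAddCommGroup E] [NormedSpace ℝ E]
    (b : SchauderBasis ℝ E) : Prop :=
  ∀ a : ℕ → ℝ, (∃ M : ℝ, ∀ n, ‖∑ i ∈ Finset.range n, a i • b i‖ ≤ M) →
    ∃ x : E, Tendsto (fun n => ∑ i ∈ Finset.range n, a i • b i) atTop (𝓝 x)

/-- `E` is reflexive: the canonical embedding into the bidual is onto. -/
def IsReflexive (E : Type*) [NormedAddCommGroup E] [NormedSpace ℝ E] : Prop :=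
  Function.Surjective (NormedSpace.inclusionInDoubleDual ℝ E)

end RichSpreading

end

open Filter Topology Pointwise

noncomputable section

namespace RichSpreading

/-! ### Convex combinations of functions converging pointwise to zero -/

/-! Closure of W under interval restrictions makes the interval projections on c₀₀ contractive, so
the unit vectors form a Schauder basis. Reflexivity is James' argument: bounded completeness turns
the coefficients of an element of the bidual into a vector, and the shrinking property shows that
this vector represents it.

Shrinking. View functionals as scalar sequences in the compact product [-1,1]^ℕ and let B be the
dual unit ball. It suffices that every g in B has asymptotic norm 0 on vectors supported far out.
This is a bootstrap: if every g in B has asymptotic norm at most θ (`TailLE`), then every g in B has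
asymptotic norm at most θ/2. The halving has two parts.

(a) W lies in the convex hull of its generators. Apart from multiples of unit vectors, each
generator is 2⁻ⁿ times an 𝒮ₙ-admissible sum of elements of B with n ≥ 1; type II functionals are of
this kind with n = 1. Let g be a pointwise limit of generators. If g has two nonzero coordinates,
the weights n stay bounded along the approximation, so a single n may be fixed. Limits of
𝒮ₙ-admissible sums inherit the bound θ: either the first summand keeps bounded support and can be
peeled off, or it swallows the whole limit. Thus g has asymptotic norm at most θ/2
(`tailLE_closure_generatorSeqs`).

(b) The closure K of the generators is compact and norming. If some f in B were larger than c + δ on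
vectors yₙ of the unit ball going to infinity, where every element of K has asymptotic norm at most
c, then suitable convex combinations of the yₙ would have norm at most c + δ/2 (dominated
convergence and Hahn–Banach), while f is still at least c + δ on them
(`tailLE_dualBall_of_closure`).

Boundedly complete. If bounded partial sums were not Cauchy, functionals in W supported arbitrarily
far out would take values at least η on the coefficient sequence. Averaging them gives α-averages of
any size with the same lower bound, and d very fast growing ones form a type I_α functional of
weight 1 with value at least dη/2, which is unbounded in d (`exists_lt_act`). -/

/-- A bounded sequence of continuous functions on a compact space which converges pointwise to `0`
has convex combinations that are uniformly small. -/
theorem exists_mem_convexHull_lt {K : Type*} [TopologicalSpace K] [CompactSpace K] [T2Space K]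
    (φ : ℕ → C(K, ℝ)) (C : ℝ) (hC : ∀ n x, |φ n x| ≤ C)
    (hlim : ∀ x, Tendsto (fun n => φ n x) atTop (𝓝 0)) {ε : ℝ} (hε : 0 < ε) :
    ∃ ψ ∈ convexHull ℝ (Set.range φ), ∀ x, ψ x < ε := by
  by_contra! hcon
  set U : Set C(K, ℝ) := {ψ | Set.MapsTo ψ Set.univ (Set.Iio ε)} with hU
  have hUo : IsOpen U := ContinuousMap.isOpen_setOfPred_mapsTo isCompact_univ isOpen_Iio
  have hUc : Convex ℝ U := by
    intro f hf g hg a b ha hb hab x hx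
    exact (convex_Iio ε) (hf hx) (hg hx) ha hb hab
  have hdisj : Disjoint U (convexHull ℝ (Set.range φ)) := by
    rw [Set.disjoint_left]
    intro ψ h1 h2
    obtain ⟨x, hx⟩ := hcon ψ h2
    exact absurd (h1 (Set.mem_univ x)) (not_lt.2 hx)
  -- If no convex combination lies below ε everywhere, the open convex set `U` of functions below ε
  -- is separated from the hull: Λ < u on `U` and Λ ≥ u on the hull.
  obtain ⟨Λ, u, h1, h2⟩ := geometric_hahn_banach_open hUc hUo (convex_convexHull ℝ _) hdisj
  have hu : 0 < u := by
    have := h1 0 (fun x _ => by simpa using hε)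
    simpa using this
  have hpos : ∀ ψ : C(K, ℝ), 0 ≤ ψ → 0 ≤ Λ ψ := by
    intro ψ hψ
    by_contra! hneg
    -- If Λ ψ < 0, this nonpositive multiple of ψ lies in `U`, although Λ takes the value u on it.
    -- Hence Λ is positive and is represented by a measure.
    have h3 := h1 ((u / Λ ψ) • ψ) (fun x _ => by
      have h4 : u / Λ ψ ≤ 0 := div_nonpos_of_nonneg_of_nonpos hu.le hneg.le
      have h5 : u / Λ ψ * ψ x ≤ 0 := mul_nonpos_of_nonpos_of_nonneg h4 (hψ x)
      simpa using h5.trans_lt hε)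
    rw [map_smul, smul_eq_mul, div_mul_cancel₀ _ hneg.ne] at h3
    exact lt_irrefl _ h3
  let inst : MeasurableSpace K := borel K
  have : BorelSpace K := ⟨rfl⟩
  let Λ' : CompactlySupportedContinuousMap K ℝ →ₚ[ℝ] ℝ := PositiveLinearMap.mk₀
    { toFun := fun f => Λ (f : C(K, ℝ))
      map_add' := fun f g => Λ.map_add (f : C(K, ℝ)) g
      map_smul' := fun r f => Λ.map_smul r (f : C(K, ℝ)) }
    (fun f hf => hpos _ hf)
  set μ := RealRMK.rieszMeasure Λ' with hμ
  have hint : ∀ ψ : C(K, ℝ), ∫ x, ψ x ∂μ = Λ ψ := fun ψ =>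
    RealRMK.integral_rieszMeasure Λ' (CompactlySupportedContinuousMap.continuousMapEquiv ψ)
  have hfin : MeasureTheory.IsFiniteMeasure μ := by
    infer_instance
  -- Dominated convergence gives Λ (φ n) → 0, against Λ (φ n) ≥ u > 0.
  have hDCT := MeasureTheory.tendsto_integral_of_dominated_convergence (μ := μ)
    (F := fun n x => φ n x) (f := fun _ => 0) (fun _ => C)
    (fun n => (φ n).continuous.aestronglyMeasurable) (MeasureTheory.integrable_const C)
    (fun n => .of_forall fun x => by simpa using hC n x) (.of_forall hlim)
  simp only [hint, MeasureTheory.integral_zero] at hDCT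
  exact absurd (ge_of_tendsto' hDCT fun n => h2 _ (subset_convexHull ℝ _ ⟨n, rfl⟩)) (not_le.2 hu)

/-! ### Reflexivity of spaces with a shrinking and boundedly complete basis -/

theorem sub_proj_mem_closure {E : Type*} [NormedAddCommGroup E] [NormedSpace ℝ E]
    (b : SchauderBasis ℝ E) (n : ℕ) (x : E) :
    x - b.proj n x ∈ (Submodule.span ℝ (b '' Set.Ici n)).topologicalClosure := by
  refine mem_closure_of_tendsto ((b.tendsto_proj x).sub_const (b.proj n x)) ?_
  filter_upwards [eventually_ge_atTop n] with m hm
  rw [SchauderBasis.proj_apply, SchauderBasis.proj_apply, ← Finset.sum_range_add_sum_Ico _ hm,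
    add_sub_cancel_left]
  exact Submodule.sum_mem _ fun i hi => Submodule.smul_mem _ _
    (Submodule.subset_span ⟨i, (Finset.mem_Ico.1 hi).1, rfl⟩)

/-- The difference evaluates f, up to sign, at x - Pₙx, a tail vector of norm at most (1 + C)‖x‖.
The norm of f on the tail therefore controls it. -/
theorem IsShrinking.tendsto_comp_proj {E : Type*} [NormedAddCommGroup E] [NormedSpace ℝ E]
    [CompleteSpace E] {b : SchauderBasis ℝ E} (hb : IsShrinking b) (f : StrongDual ℝ E) :
    Tendsto (fun n => f.comp (b.proj n)) atTop (𝓝 f) := by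
  obtain ⟨C, hC⟩ := b.exists_norm_proj_le
  have hC0 : 0 ≤ C := (norm_nonneg _).trans (hC 0)
  rw [tendsto_iff_norm_sub_tendsto_zero]
  have h := (hb f).mul_const (1 + C)
  rw [zero_mul] at h
  refine squeeze_zero (fun n => norm_nonneg _) (fun n => ?_) h
  refine ContinuousLinearMap.opNorm_le_bound _ (by positivity) fun x => ?_
  have h1 := (f.comp (Submodule.span ℝ (b '' Set.Ici n)).topologicalClosure.subtypeL).le_opNorm
    ⟨x - b.proj n x, sub_proj_mem_closure b n x⟩
  have h2 : ‖x - b.proj n x‖ ≤ (1 + C) * ‖x‖ := by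
    refine (norm_sub_le _ _).trans ?_
    rw [add_mul, one_mul]
    gcongr
    exact (b.proj n).le_of_opNorm_le (hC n) x
  calc ‖(f.comp (b.proj n) - f) x‖ = ‖f (x - b.proj n x)‖ := by
        rw [← norm_neg, map_sub]
        simp
    _ ≤ _ := h1
    _ ≤ _ := by
      rw [mul_assoc]
      gcongr
      exact h2

/-- A Banach space with a shrinking and boundedly complete Schauder basis is reflexive. -/
theorem isReflexive_of_basis {E : Type*} [NormedAddCommGroup E] [NormedSpace ℝ E]
    [CompleteSpace E] {b : SchauderBasis ℝ E} (hb : IsShrinking b) (hb' : IsBoundedlyComplete b) :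
    IsReflexive E := by
  intro φ
  obtain ⟨C, hC⟩ := b.exists_norm_proj_le
  have hC0 : 0 ≤ C := (norm_nonneg _).trans (hC 0)
  -- On the partial sums with coefficients φ(bᵢ*), f acts as φ does on f ∘ Pₙ. This bounds the
  -- partial sums and later identifies their limit with φ.
  have hφ : ∀ (n : ℕ) (f : StrongDual ℝ E),
      f (∑ i ∈ Finset.range n, φ (b.coord i) • b i) = φ (f.comp (b.proj n)) := by
    intro n f
    have h : f.comp (b.proj n) = ∑ i ∈ Finset.range n, f (b i) • b.coord i := by
      ext x
      simp [mul_comm]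
    rw [h, map_sum, map_sum]
    refine Finset.sum_congr rfl fun i _ => ?_
    rw [map_smul, map_smul, smul_eq_mul, smul_eq_mul, mul_comm]
  obtain ⟨x, hx⟩ := hb' (fun i => φ (b.coord i)) ⟨‖φ‖ * C, fun n => by
    refine NormedSpace.norm_le_dual_bound ℝ _ (by positivity) fun f => ?_
    rw [hφ, mul_assoc]
    refine (φ.le_opNorm _).trans ?_
    gcongr
    rw [mul_comm]
    refine (f.opNorm_comp_le _).trans ?_
    gcongr
    exact hC n⟩
  refine ⟨x, ?_⟩
  ext f
  rw [NormedSpace.dual_def]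
  refine tendsto_nhds_unique ((f.continuous.tendsto x).comp hx) ?_
  refine ((φ.continuous.tendsto f).comp (hb.tendsto_comp_proj f)).congr fun n => ?_
  exact (hφ n f).symm

/-! ### Functionals as scalar sequences and their behaviour at infinity -/

/-- The action of a scalar sequence on a finitely supported vector. -/
def act (g : ℕ+ → ℝ) (x : C00) : ℝ := x.sum fun i t => g i * t

theorem act_coe (f x : C00) : act f x = pairing f x := rfl

theorem act_add_left (f g : ℕ+ → ℝ) (x : C00) : act (f + g) x = act f x + act g x := by
  simp [act, Finsupp.sum, add_mul, Finset.sum_add_distrib]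

theorem act_smul_left (c : ℝ) (g : ℕ+ → ℝ) (x : C00) : act (c • g) x = c * act g x := by
  simp [act, Finsupp.sum, Finset.mul_sum, mul_assoc]

theorem act_add_right (g : ℕ+ → ℝ) (x y : C00) : act g (x + y) = act g x + act g y :=
  Finsupp.sum_add_index' (by simp) (by intros; ring)

theorem act_smul_right (g : ℕ+ → ℝ) (r : ℝ) (x : C00) : act g (r • x) = r * act g x := by
  unfold act
  rw [Finsupp.sum_smul_index (by simp), Finsupp.mul_sum]
  exact Finsupp.sum_congr fun _ _ => by ring

theorem act_single (g : ℕ+ → ℝ) (i : ℕ+) : act g (Finsupp.single i 1) = g i := by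
  simp [act]

theorem continuous_act (x : C00) : Continuous fun g => act g x := by
  unfold act Finsupp.sum
  fun_prop

theorem act_eq_zero {g : ℕ+ → ℝ} {x : C00} {N : ℕ+} (hg : ∀ i, N < i → g i = 0)
    (hx : ∀ i ≤ N, x i = 0) : act g x = 0 := by
  refine Finset.sum_eq_zero fun i _ => ?_
  rcases le_or_gt i N with h | h
  · simp [hx i h]
  · simp [hg i h]

/-- The scalar sequences which act on `c₀₀` as functionals of norm at most `1`. -/
def dualBall (P : Choices) : Set (ℕ+ → ℝ) := {g | ∀ x : PreX P, |act g (toC00 P x)| ≤ ‖x‖}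

/-- Asymptotically, `g` has norm at most `θ` on vectors supported far out. -/
def TailLE (P : Choices) (θ : ℝ) (g : ℕ+ → ℝ) : Prop :=
  ∀ δ > 0, ∃ N : ℕ+, ∀ x : PreX P, (∀ i ≤ N, toC00 P x i = 0) →
    |act g (toC00 P x)| ≤ (θ + δ) * ‖x‖

variable {P : Choices} {θ : ℝ}

theorem TailLE.mono {θ' : ℝ} (h : θ ≤ θ') {g : ℕ+ → ℝ} (hg : TailLE P θ g) : TailLE P θ' g := by
  intro δ hδ
  obtain ⟨N, hN⟩ := hg δ hδ
  exact ⟨N, fun x hx => (hN x hx).trans (by gcongr)⟩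

theorem TailLE.of_eventually_zero (hθ : 0 ≤ θ) {g : ℕ+ → ℝ} {N : ℕ+} (hg : ∀ i, N < i → g i = 0) :
    TailLE P θ g := by
  intro δ hδ
  refine ⟨N, fun x hx => ?_⟩
  rw [act_eq_zero hg hx, abs_zero]
  positivity

/-- `TailLE` looks only at vectors far out, so a finitely supported perturbation is invisible to it.
-/
theorem TailLE.add_left {g a : ℕ+ → ℝ} (hg : TailLE P θ g) {M : ℕ+} (ha : ∀ i, M < i → a i = 0) :
    TailLE P θ (a + g) := by
  intro δ hδ
  obtain ⟨N, hN⟩ := hg δ hδ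
  refine ⟨max M N, fun x hx => ?_⟩
  rw [act_add_left, act_eq_zero ha fun i hi => hx i (hi.trans (le_max_left _ _)), zero_add]
  exact hN x fun i hi => hx i (hi.trans (le_max_right _ _))

theorem TailLE.smul {g : ℕ+ → ℝ} (hg : TailLE P θ g) {c : ℝ} (hc : 0 < c) :
    TailLE P (c * θ) (c • g) := by
  intro δ hδ
  obtain ⟨N, hN⟩ := hg (δ / c) (by positivity)
  refine ⟨N, fun x hx => ?_⟩
  rw [act_smul_left, abs_mul, abs_of_pos hc]
  calc c * |act g (toC00 P x)| ≤ c * ((θ + δ / c) * ‖x‖) := by gcongr; exact hN x hx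
    _ = (c * θ + δ) * ‖x‖ := by field_simp

/-- Closed for pointwise convergence, since each test vector involves finitely many coordinates. -/
theorem isClosed_dualBall (P : Choices) : IsClosed (dualBall P) := by
  simp only [dualBall, Set.ofPred_forall]
  exact isClosed_iInter fun x => isClosed_le (continuous_act _).abs continuous_const

theorem norm_single_le (P : Choices) (i : ℕ+) :
    ‖((toC00 P).symm (Finsupp.single i 1) : PreX P)‖ ≤ 1 := by
  refine norm_le_of_forall fun f hf => ?_
  rw [LinearEquiv.apply_symm_apply, ← act_coe, act_single]
  exact (le_abs_self _).trans (abs_le_one_of_mem hf i)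

/-- The scalar sequences with coordinates in `[-1, 1]`. -/
def box : Set (ℕ+ → ℝ) := Set.univ.pi fun _ => Set.Icc (-1) 1

theorem mem_box {g : ℕ+ → ℝ} : g ∈ box ↔ ∀ i, |g i| ≤ 1 := by
  simp [box, abs_le, Pi.le_def, forall_and]

theorem isCompact_box : IsCompact box := isCompact_univ_pi fun _ => isCompact_Icc

theorem isClosed_box : IsClosed box := isCompact_box.isClosed

theorem dualBall_subset_box (P : Choices) : dualBall P ⊆ box := by
  intro g hg
  rw [mem_box]
  intro i
  have h := hg ((toC00 P).symm (Finsupp.single i 1))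
  rw [LinearEquiv.apply_symm_apply, act_single] at h
  exact h.trans (norm_single_le P i)

theorem mem_dualBall_of_mem {f : C00} (hf : f ∈ normingSet P) : ⇑f ∈ dualBall P :=
  fun x => abs_pairing_le_norm hf x

/-! ### Successive sums -/

/-- The supports of `G 0, G 1, …` are successive. -/
def SuccSupp {k : ℕ} (G : Fin k → ℕ+ → ℝ) : Prop :=
  ∀ i j, i < j → ∀ a b, G i a ≠ 0 → G j b ≠ 0 → a < b

/-- Sums of `k` elements of `A` with successive supports. -/
def succSums (A : Set (ℕ+ → ℝ)) (k : ℕ) : Set (ℕ+ → ℝ) :=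
  {g | ∃ G : Fin k → ℕ+ → ℝ, (∀ j, G j ∈ A) ∧ SuccSupp G ∧ g = ∑ j, G j}

/-- Sums of elements of `A` with successive supports, whose number is at most the minimum of the
supports. -/
def schreierSums (A : Set (ℕ+ → ℝ)) : Set (ℕ+ → ℝ) :=
  {g | ∃ (k : ℕ) (G : Fin k → ℕ+ → ℝ), (∀ j, G j ∈ A) ∧ SuccSupp G ∧
    (∀ j a, G j a ≠ 0 → k ≤ (a : ℕ)) ∧ g = ∑ j, G j}

theorem succSums_subset_box {A : Set (ℕ+ → ℝ)} (hA : A ⊆ box) (k : ℕ) : succSums A k ⊆ box := by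
  rintro g ⟨G, h1, h2, rfl⟩
  rw [mem_box]
  intro i
  rw [Finset.sum_apply]
  refine abs_sum_le_of_disjoint _ _ 1 zero_le_one (fun j _ => mem_box.1 (hA (h1 j)) i) ?_
  intro p _ q _ hpq
  by_contra! hc
  rcases lt_or_gt_of_ne hpq with h | h
  · exact lt_irrefl _ (h2 p q h i i hc.1 hc.2)
  · exact lt_irrefl _ (h2 q p h i i hc.2 hc.1)

theorem schreierSums_subset_box {A : Set (ℕ+ → ℝ)} (hA : A ⊆ box) : schreierSums A ⊆ box := by
  rintro g ⟨k, G, h1, h2, -, rfl⟩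
  exact succSums_subset_box hA k ⟨G, h1, h2, rfl⟩

/-- Compactness of the box makes the sum of the two closures closed, so a limit of sums splits as a
sum of limits. -/
theorem closure_add_subset {A B : Set (ℕ+ → ℝ)} (hA : A ⊆ box) (hB : B ⊆ box) {g : ℕ+ → ℝ}
    (hg : g ∈ closure (A + B)) : ∃ a ∈ closure A, ∃ b ∈ closure B, a + b = g := by
  have h1 : IsCompact (closure A) := isCompact_box.of_isClosed_subset isClosed_closure
    (closure_minimal hA isClosed_box)
  have h2 : IsCompact (closure B) := isCompact_box.of_isClosed_subset isClosed_closure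
    (closure_minimal hB isClosed_box)
  exact Set.mem_add.1 (closure_minimal (Set.add_subset_add subset_closure subset_closure)
    (h1.add h2).isClosed hg)

theorem tailLE_closure_succSums (hθ : 0 ≤ θ) {A : Set (ℕ+ → ℝ)} (hA : A ⊆ box)
    (h : ∀ g ∈ closure A, TailLE P θ g) (k : ℕ) :
    ∀ g ∈ closure (succSums A k), TailLE P θ g := by
  induction k with
  | zero =>
    intro g hg
    have h0 : succSums A 0 ⊆ {0} := by
      rintro g ⟨G, -, -, rfl⟩
      simp
    have hg0 : g = 0 := by simpa using closure_mono h0 hg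
    exact TailLE.of_eventually_zero (N := 1) hθ fun i _ => by simp [hg0]
  | succ k ih =>
    intro g hg
    obtain ⟨f, hf, hlim⟩ := mem_closure_iff_seq_limit.1 hg
    choose G hG1 hG2 hG3 using hf
    have hG4 : ∀ t, f t = G t 0 + ∑ j : Fin k, G t j.succ := fun t => by
      rw [hG3 t, Fin.sum_univ_succ]
    have hG5 : ∀ t, ∑ j : Fin k, G t j.succ ∈ succSums A k := fun t =>
      ⟨fun j => G t j.succ, fun j => hG1 t _,
        fun i j hij => hG2 t _ _ (Fin.succ_lt_succ_iff.2 hij), rfl⟩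
    -- Either the first summands are supported in a fixed [1, N] infinitely often, and their limit
    -- is a finitely supported perturbation of a limit of k-fold sums; or their supports eventually
    -- pass every N. Then the later summands vanish on each fixed coordinate, and g is a limit of
    -- first summands alone.
    by_cases hN : ∃ N : ℕ+, ∃ᶠ t in atTop, ∀ i, N < i → G t 0 i = 0
    · obtain ⟨N, hN⟩ := hN
      have h1 : g ∈ closure ({a ∈ A | ∀ i, N < i → a i = 0} + succSums A k) := by
        refine mem_closure_of_frequently_of_tendsto (hN.mono fun t ht => ?_) hlim
        rw [hG4 t]
        exact Set.add_mem_add ⟨hG1 t 0, ht⟩ (hG5 t)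
      obtain ⟨a, ha, b, hb, rfl⟩ := closure_add_subset (fun a ha => hA ha.1)
        (succSums_subset_box hA k) h1
      refine (ih b hb).add_left (M := N) fun i hi => ?_
      have h2 : IsClosed {a : ℕ+ → ℝ | a i = 0} := isClosed_eq (continuous_apply i) continuous_const
      exact closure_minimal (fun a ha => ha.2 i hi) h2 ha
    · push Not at hN
      refine h g (mem_closure_of_tendsto (b := atTop) (f := fun t => G t 0) ?_
        (.of_forall fun t => hG1 t 0))
      rw [tendsto_pi_nhds] at hlim ⊢
      intro i
      refine (hlim i).congr' ?_
      filter_upwards [hN i] with t ht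
      obtain ⟨a, hia, ha⟩ := ht
      rw [hG4 t, Pi.add_apply, Finset.sum_apply, Finset.sum_eq_zero, add_zero]
      intro j _
      by_contra hj
      exact absurd (hG2 t 0 j.succ (Fin.succ_pos j) a i ha hj) (not_lt.2 hia.le)

/-- A nonzero coordinate i of the limit is nonzero for nearby sums too, which forces their number of
summands to be at most i. This reduces to finitely many sets `succSums A k`. -/
theorem tailLE_closure_schreierSums (hθ : 0 ≤ θ) {A : Set (ℕ+ → ℝ)} (hA : A ⊆ box)
    (h : ∀ g ∈ closure A, TailLE P θ g) :
    ∀ g ∈ closure (schreierSums A), TailLE P θ g := by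
  intro g hg
  by_cases h0 : ∀ i, g i = 0
  · exact TailLE.of_eventually_zero (N := 1) hθ fun i _ => h0 i
  push Not at h0
  obtain ⟨i, hi⟩ := h0
  have h1 : g ∈ closure (⋃ k ∈ Set.Iic (i : ℕ), succSums A k) := by
    have hopen : IsOpen {f : ℕ+ → ℝ | f i ≠ 0} := isOpen_ne_fun (continuous_apply i) continuous_const
    have h2 := hopen.inter_closure ⟨hi, hg⟩
    refine closure_mono ?_ h2
    rintro f ⟨hfi, k, G, hG1, hG2, hG3, rfl⟩
    have hfi' : ∑ j, G j i ≠ 0 := by simpa using hfi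
    obtain ⟨j, -, hj⟩ := Finset.exists_ne_zero_of_sum_ne_zero hfi'
    exact Set.mem_biUnion (hG3 j i hj) ⟨G, hG1, hG2, rfl⟩
  rw [(Set.finite_Iic _).closure_biUnion] at h1
  obtain ⟨k, -, hk⟩ := Set.mem_iUnion₂.1 h1
  exact tailLE_closure_succSums hθ hA h k g hk

/-- The sums of elements of the dual ball which are admissible in the sense of the `n`-th Schreier
family. -/
def iterSums (P : Choices) : ℕ → Set (ℕ+ → ℝ)
  | 0 => dualBall P
  | n + 1 => schreierSums (iterSums P n)

theorem iterSums_subset_box (P : Choices) : ∀ n, iterSums P n ⊆ box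
  | 0 => dualBall_subset_box P
  | n + 1 => schreierSums_subset_box (iterSums_subset_box P n)

theorem tailLE_closure_iterSums (hθ : 0 ≤ θ) (h : ∀ g ∈ dualBall P, TailLE P θ g) :
    ∀ n, ∀ g ∈ closure (iterSums P n), TailLE P θ g
  | 0 => by
    rw [iterSums, (isClosed_dualBall P).closure_eq]
    exact h
  | n + 1 => tailLE_closure_schreierSums hθ (iterSums_subset_box P n)
      (tailLE_closure_iterSums hθ h n)

/-- Induction along the definition of the Schreier families, with each summand indexed by a lower
bound m of its support that lies in F. The last hypothesis keeps each support before the next index.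
-/
theorem sum_mem_iterSums {n : ℕ} {F : Finset ℕ+} (hF : F ∈ schreier (n + 1))
    {h : ℕ+ → ℕ+ → ℝ} (h1 : ∀ m ∈ F, h m ∈ dualBall P)
    (h2 : ∀ m ∈ F, ∀ i, h m i ≠ 0 → m ≤ i)
    (h3 : ∀ m ∈ F, ∀ i, h m i ≠ 0 → ∀ m' ∈ F, m < m' → i < m') :
    ∑ m ∈ F, h m ∈ iterSums P (n + 1) := by
  induction n generalizing F with
  | zero =>
    have hF' : ∀ m ∈ F, F.card ≤ (m : ℕ) := hF
    have hmem : ∀ j, F.orderEmbOfFin rfl j ∈ F := F.orderEmbOfFin_mem rfl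
    refine ⟨F.card, fun j => h (F.orderEmbOfFin rfl j), fun j => h1 _ (hmem j), ?_, ?_, ?_⟩
    · intro i j hij a b ha hb
      exact (h3 _ (hmem i) a ha _ (hmem j) ((F.orderEmbOfFin rfl).strictMono hij)).trans_le
        (h2 _ (hmem j) b hb)
    · intro j a ha
      exact (hF' _ (hmem j)).trans (h2 _ (hmem j) a ha)
    · conv_lhs => rw [← F.map_orderEmbOfFin_univ rfl, Finset.sum_map]
      rfl
  | succ n ih =>
    obtain ⟨k, A, rfl, hA1, hA2, hA3⟩ := hF
    have hmem : ∀ j, ∀ m ∈ A j, m ∈ Finset.univ.biUnion A := fun j m hm =>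
      Finset.mem_biUnion.2 ⟨j, Finset.mem_univ j, hm⟩
    have hne : ∀ j a, (∑ m ∈ A j, h m) a ≠ 0 → ∃ m ∈ A j, h m a ≠ 0 := fun j a ha => by
      rw [Finset.sum_apply] at ha
      exact Finset.exists_ne_zero_of_sum_ne_zero ha
    refine ⟨k, fun j => ∑ m ∈ A j, h m, fun j => ih (hA1 j).1 (fun m hm => h1 m (hmem j m hm))
      (fun m hm => h2 m (hmem j m hm))
      (fun m hm i hi m' hm' => h3 m (hmem j m hm) i hi m' (hmem j m' hm')), ?_, ?_, ?_⟩
    · intro i j hij a b ha hb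
      obtain ⟨m, hm, hma⟩ := hne i a ha
      obtain ⟨m', hm', hmb⟩ := hne j b hb
      exact (h3 m (hmem i m hm) a hma m' (hmem j m' hm') (hA2 i j hij m hm m' hm')).trans_le
        (h2 m' (hmem j m' hm') b hmb)
    · intro j a ha
      obtain ⟨m, hm, hma⟩ := hne j a ha
      exact (hA3 m (hmem j m hm)).trans (h2 m (hmem j m hm) a hma)
    · refine Finset.sum_biUnion fun i _ j _ hij => Finset.disjoint_left.2 fun a ha hb => ?_
      rcases lt_or_gt_of_ne hij with hlt | hlt
      · exact lt_irrefl _ (hA2 i j hlt a ha a hb)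
      · exact lt_irrefl _ (hA2 j i hlt a hb a ha)

/-! ### Generators of the norming set -/

theorem restrict_apply (E : Set ℕ+) (f : C00) (i : ℕ+) [Decidable (i ∈ E)] :
    restrict E f i = if i ∈ E then f i else 0 := by
  unfold restrict
  rw [Finsupp.filter_apply]
  congr

theorem restrict_add (E : Set ℕ+) (f g : C00) : restrict E (f + g) = restrict E f + restrict E g := by
  classical
  ext i
  simp only [restrict_apply, Finsupp.add_apply]
  split_ifs <;> simp

theorem restrict_smul (E : Set ℕ+) (c : ℝ) (f : C00) : restrict E (c • f) = c • restrict E f := by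
  classical
  ext i
  simp [restrict_apply]

theorem restrict_sum (E : Set ℕ+) {ι : Type*} (s : Finset ι) (f : ι → C00) :
    restrict E (∑ i ∈ s, f i) = ∑ i ∈ s, restrict E (f i) := by
  classical
  ext i
  simp only [restrict_apply, Finsupp.finsetSum_apply]
  split_ifs <;> simp

theorem restrict_restrict (E E' : Set ℕ+) (f : C00) :
    restrict E (restrict E' f) = restrict (E ∩ E') f := by
  classical
  ext i
  simp only [restrict_apply, Set.mem_inter_iff]
  split_ifs <;> simp_all

/-- The functionals of types I and II, together with the multiples of unit vectors, in the norming
set. -/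
def generators (P : Choices) : Set C00 :=
  {f | f ∈ normingSet P ∧ ((∃ i c, f = Finsupp.single i c) ∨
    (∃ n, IsTypeIAlpha (normingSet P) n f) ∨ (∃ n, IsTypeIBeta P (normingSet P) n f) ∨
    ∃ S, IsTypeII P (normingSet P) S f)}

theorem IsTypeI.neg {A : ℕ → C00 → Prop} {n : ℕ} {f : C00} (h : IsTypeI A n f) :
    IsTypeI A n (-f) := by
  obtain ⟨h1, d, α, s, E, ε, h2, h3, h4, h5, rfl⟩ := h
  exact ⟨h1, d, α, s, E, -ε, h2, h3, h4, h5, by simp⟩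

theorem IsTypeI.restrict {A : ℕ → C00 → Prop} {n : ℕ} {f : C00} (h : IsTypeI A n f)
    {E : Set ℕ+} (hE : E.OrdConnected) : IsTypeI A n (restrict E f) := by
  obtain ⟨h1, d, α, s, E', ε, h2, h3, h4, h5, rfl⟩ := h
  exact ⟨h1, d, α, s, E ∩ E', ε, h2, h3, h4, hE.inter h5, by
    rw [restrict_smul, restrict_restrict]⟩

theorem IsTypeII.neg {G : Set C00} {S : Set ℕ} {f : C00} (h : IsTypeII P G S f) :
    IsTypeII P G S (-f) := by
  rcases h with ⟨d, f, g, w, F, hF, E, ε, h1, h2, h3, h4, rfl, h5⟩ |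
    ⟨d, f, g, w, F, hF, c, E, ε, h1, h2, h3, h6, h4, rfl, h5⟩
  · exact .inl ⟨d, f, g, w, F, hF, E, -ε, h1, h2, h3, h4, by simp, h5⟩
  · exact .inr ⟨d, f, g, w, F, hF, c, E, -ε, h1, h2, h3, h6, h4, by simp, h5⟩

/-- Cutting down the interval can remove weights, hence the new set S'. -/
theorem IsTypeII.restrict {G : Set C00} {S : Set ℕ} {f : C00} (h : IsTypeII P G S f)
    {E : Set ℕ+} (hE : E.OrdConnected) : ∃ S', IsTypeII P G S' (restrict E f) := by
  rcases h with ⟨d, f, g, w, F, hF, E', ε, h1, h2, h3, h4, rfl, h5⟩ |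
    ⟨d, f, g, w, F, hF, c, E', ε, h1, h2, h3, h6, h4, rfl, h5⟩
  · exact ⟨_, .inl ⟨d, f, g, w, F, hF, E ∩ E', ε, h1, h2, h3, hE.inter h4, by
      rw [restrict_smul, restrict_restrict], rfl⟩⟩
  · exact ⟨_, .inr ⟨d, f, g, w, F, hF, c, E ∩ E', ε, h1, h2, h3, h6, hE.inter h4, by
      rw [restrict_smul, restrict_restrict], rfl⟩⟩

theorem neg_mem_generators {f : C00} (hf : f ∈ generators P) : -f ∈ generators P := by
  refine ⟨(normingSet_isNormingClosed P).neg f hf.1, ?_⟩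
  rcases hf.2 with ⟨i, c, rfl⟩ | ⟨n, h⟩ | ⟨n, h⟩ | ⟨S, h⟩
  · exact .inl ⟨i, -c, by simp⟩
  · exact .inr (.inl ⟨n, IsTypeI.neg h⟩)
  · exact .inr (.inr (.inl ⟨n, IsTypeI.neg h⟩))
  · exact .inr (.inr (.inr ⟨S, h.neg⟩))

theorem restrict_mem_generators {f : C00} (hf : f ∈ generators P) {E : Set ℕ+}
    (hE : E.OrdConnected) : restrict E f ∈ generators P := by
  refine ⟨(normingSet_isNormingClosed P).restrict f hf.1 E hE, ?_⟩
  rcases hf.2 with ⟨i, c, rfl⟩ | ⟨n, h⟩ | ⟨n, h⟩ | ⟨S, h⟩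
  · classical
    -- Arbitrary multiples, zero included, are allowed among the generators so that this restriction
    -- stays inside.
    refine .inl ⟨i, if i ∈ E then c else 0, ?_⟩
    ext j
    rw [restrict_apply, Finsupp.single_apply, Finsupp.single_apply]
    split_ifs <;> simp_all
  · exact .inr (.inl ⟨n, IsTypeI.restrict h hE⟩)
  · exact .inr (.inr (.inl ⟨n, IsTypeI.restrict h hE⟩))
  · exact .inr (.inr (.inr (h.restrict hE)))

/-- By minimality of W it is enough that W ∩ conv(generators) has the closure properties.
Intersecting with W matters: functionals built from pieces in the intersection have their pieces in
W, so they are themselves generators. -/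
theorem normingSet_subset_convexHull (P : Choices) :
    normingSet P ⊆ convexHull ℝ (generators P) := by
  have hW := normingSet_isNormingClosed P
  have hsub : normingSet P ∩ convexHull ℝ (generators P) ⊆ normingSet P := Set.inter_subset_left
  have hgen : ∀ f ∈ generators P, f ∈ normingSet P ∩ convexHull ℝ (generators P) := fun f hf =>
    ⟨hf.1, subset_convexHull ℝ _ hf⟩
  have key : IsNormingClosed P (normingSet P ∩ convexHull ℝ (generators P)) :=
  { basis := fun n => ⟨hgen _ ⟨(hW.basis n).1, .inl ⟨n, 1, rfl⟩⟩,
      hgen _ (neg_mem_generators ⟨(hW.basis n).1, .inl ⟨n, 1, rfl⟩⟩)⟩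
    neg := fun f hf => by
      refine ⟨hW.neg f hf.1, ?_⟩
      have h : convexHull ℝ (generators P) ⊆ {f | -f ∈ convexHull ℝ (generators P)} := by
        refine convexHull_min (fun f hf => subset_convexHull ℝ _ (neg_mem_generators hf)) ?_
        exact (convex_convexHull ℝ _).is_linear_preimage
          (LinearMap.isLinear (-LinearMap.id : C00 →ₗ[ℝ] C00))
      exact h hf.2
    restrict := fun f hf E hE => by
      refine ⟨hW.restrict f hf.1 E hE, ?_⟩
      have h : convexHull ℝ (generators P) ⊆
          {f | RichSpreading.restrict E f ∈ convexHull ℝ (generators P)} := by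
        refine convexHull_min (fun f hf => subset_convexHull ℝ _ (restrict_mem_generators hf hE)) ?_
        exact (convex_convexHull ℝ _).is_linear_preimage
          ⟨restrict_add E, restrict_smul E⟩
      exact h hf.2
    convex := fun n c f h0 h1 hf => by
      refine ⟨hW.convex n c f h0 h1 fun i => (hf i).1, ?_⟩
      exact (convex_convexHull ℝ _).sum_mem (fun i _ => by exact_mod_cast h0 i)
        (by exact_mod_cast h1) fun i _ => (hf i).2
    alpha := fun n f hf => hgen f ⟨hW.alpha n f (hf.mono hsub), .inr (.inl ⟨n, hf.mono hsub⟩)⟩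
    beta := fun n f hf =>
      hgen f ⟨hW.beta n f (hf.mono hsub), .inr (.inr (.inl ⟨n, hf.mono hsub⟩))⟩
    plus := fun S f hf =>
      hgen f ⟨hW.plus S f (hf.mono hsub), .inr (.inr (.inr ⟨S, .inl (hf.mono hsub)⟩))⟩
    minus := fun S f hf =>
      hgen f ⟨hW.minus S f (hf.mono hsub), .inr (.inr (.inr ⟨S, .inr (hf.mono hsub)⟩))⟩ }
  exact fun f hf => (normingSet_subset key hf).2

/-! ### Generators as admissible sums -/

theorem smul_mem_dualBall {g : ℕ+ → ℝ} (hg : g ∈ dualBall P) {c : ℝ} (hc : |c| ≤ 1) :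
    c • g ∈ dualBall P := by
  intro x
  rw [act_smul_left, abs_mul]
  exact (mul_le_of_le_one_left (abs_nonneg _) hc).trans (hg x)

theorem minSupp_le_maxSupp {f : C00} (hf : f ≠ 0) : minSupp f ≤ maxSupp f := by
  obtain ⟨i, hi⟩ := Finsupp.ne_iff.1 hf
  exact (le_of_mem_support hi).1.trans (le_of_mem_support hi).2

/-- Admissibility is known for the original vectors v, while the sum involves their signed, scaled
or restricted versions u. Indexing by `minSupp (v p)` suffices, as supports only shrink. -/
theorem sum_mem_iterSums_of_family {ι : Type*} [Fintype ι] {n : ℕ} {v : ι → C00}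
    (hv : ∀ p, v p ≠ 0)
    (hlt : ∀ p p', p ≠ p' → maxSupp (v p) < minSupp (v p') ∨ maxSupp (v p') < minSupp (v p))
    (hS : Finset.univ.image (fun p => minSupp (v p)) ∈ schreier (n + 1)) {u : ι → ℕ+ → ℝ}
    (hu : ∀ p, u p ∈ dualBall P) (huv : ∀ p i, u p i ≠ 0 → v p i ≠ 0) :
    ∑ p, u p ∈ iterSums P (n + 1) := by
  classical
  have hinj : Function.Injective fun p => minSupp (v p) := by
    intro p p' hpp
    by_contra hne
    have hpp' : minSupp (v p) = minSupp (v p') := hpp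
    rcases hlt p p' hne with h | h
    · exact absurd (minSupp_le_maxSupp (hv p)) (not_le.2 (hpp' ▸ h))
    · exact absurd (minSupp_le_maxSupp (hv p')) (not_le.2 (hpp' ▸ h))
  have hext : ∀ p, Function.extend (fun p => minSupp (v p)) u 0 (minSupp (v p)) = u p :=
    fun p => hinj.extend_apply u 0 p
  have hsum : ∑ p, u p = ∑ m ∈ Finset.univ.image (fun p => minSupp (v p)),
      Function.extend (fun p => minSupp (v p)) u 0 m := by
    rw [Finset.sum_image fun p _ p' _ h => hinj h]
    exact Finset.sum_congr rfl fun p _ => (hext p).symm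
  rw [hsum]
  refine sum_mem_iterSums hS ?_ ?_ ?_
  · intro m hm
    obtain ⟨p, -, rfl⟩ := Finset.mem_image.1 hm
    rw [hext]
    exact hu p
  · intro m hm i hi
    obtain ⟨p, -, rfl⟩ := Finset.mem_image.1 hm
    rw [hext] at hi
    exact (le_of_mem_support (huv p i hi)).1
  · intro m hm i hi m' hm' hmm
    obtain ⟨p, -, rfl⟩ := Finset.mem_image.1 hm
    obtain ⟨p', -, rfl⟩ := Finset.mem_image.1 hm'
    rw [hext] at hi
    have hne : p ≠ p' := by
      rintro rfl
      exact lt_irrefl _ hmm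
    rcases hlt p p' hne with h | h
    · exact (le_of_mem_support (huv p i hi)).2.trans_lt h
    · exact absurd ((minSupp_le_maxSupp (hv p')).trans_lt h) (not_lt.2 hmm.le)

theorem abs_sign (ε : ℤˣ) : |((ε : ℤ) : ℝ)| = 1 := by
  rcases Int.units_eq_one_or ε with rfl | rfl <;> simp

theorem coe_mem_dualBall {f : C00} (hf : f ∈ normingSet P) {E : Set ℕ+} (hE : E.OrdConnected)
    {c : ℝ} (hc : |c| ≤ 1) : ⇑(c • restrict E f) ∈ dualBall P := by
  rw [Finsupp.coe_smul]
  exact smul_mem_dualBall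
    (mem_dualBall_of_mem ((normingSet_isNormingClosed P).restrict f hf E hE)) hc

theorem smul_restrict_ne_zero {f : C00} {E : Set ℕ+} {c : ℝ} {i : ℕ+}
    (h : (c • restrict E f) i ≠ 0) : f i ≠ 0 := by
  classical
  intro h0
  apply h
  rw [Finsupp.smul_apply, restrict_apply, h0]
  simp

theorem IsTypeI.mem_smul_iterSums {A : ℕ → C00 → Prop} (hA : ∀ n f, A n f → f ∈ normingSet P)
    {n : ℕ} {f : C00} (h : IsTypeI A n f) :
    1 ≤ n ∧ ⇑f ∈ (1 / (2 : ℝ) ^ n) • iterSums P n := by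
  obtain ⟨h1, d, α, s, E, ε, h2, h3, -, h5, rfl⟩ := h
  refine ⟨h1, Set.mem_smul_set.2 ⟨∑ q, ⇑(((ε : ℤ) : ℝ) • RichSpreading.restrict E (α q)), ?_, ?_⟩⟩
  · obtain ⟨n, rfl⟩ := Nat.exists_eq_add_of_le' h1
    refine sum_mem_iterSums_of_family (v := α) h3.1.1 (fun p p' hne => ?_) h3.2
      (fun p => coe_mem_dualBall (hA _ _ (h2 p)) h5 (abs_sign ε).le)
      fun p i hi => smul_restrict_ne_zero hi
    rcases lt_or_gt_of_ne hne with hlt | hlt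
    · exact .inl (h3.1.2 p p' hlt).2.2
    · exact .inr (h3.1.2 p' p hlt).2.2
  · rw [restrict_smul, restrict_sum, smul_comm, Finset.smul_sum, Finsupp.coe_smul]
    ext i
    simp [Finset.mul_sum]

/-- The 2#F vectors f_q, g_q are successive and start after 2#F, so they are 𝒮₁-admissible; the
factor 1/2 plays the role of 2⁻¹. Both kinds of type II functionals are covered by the choice of a
and b. -/
theorem IsSpecial.mem_smul_iterSums {d : ℕ} {f g : ℕ → C00} {w : ℕ → ℕ}
    (h : IsSpecial P (normingSet P) d f g w) {F : Finset ℕ} (hF : F.Nonempty)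
    (hFd : F ⊆ Finset.range d) (hcard : 2 * F.card ≤ (minSupp (f (F.min' hF)) : ℕ))
    {E : Set ℕ+} (hE : E.OrdConnected) {a b : ℕ → ℝ} (ha : ∀ q ∈ F, |a q| ≤ 1)
    (hb : ∀ q ∈ F, |b q| ≤ 1) (ε : ℤˣ) :
    ⇑(((ε : ℤ) : ℝ) • restrict E ((1 / 2 : ℝ) • ∑ q ∈ F, (a q • f q + b q • g q))) ∈
      (1 / (2 : ℝ) ^ 1) • iterSums P 1 := by
  classical
  have hd : ∀ q : F, (q : ℕ) < d := fun q => Finset.mem_range.1 (hFd q.2)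
  -- The Boolean selects f_q (`false`) or g_q (`true`).
  let v : F × Bool → C00 := fun p => bif p.2 then g p.1 else f p.1
  let c : F × Bool → ℝ := fun p => bif p.2 then b p.1 else a p.1
  have hv : ∀ p, v p ≠ 0 := by
    rintro ⟨q, _ | _⟩
    · exact (h.lt_pair q (hd q)).1
    · exact (h.lt_pair q (hd q)).2.1
  have hfg : ∀ q : F, maxSupp (f q) < minSupp (g q) := fun q => (h.lt_pair q (hd q)).2.2
  have hf : ∀ q : F, minSupp (f q) ≤ maxSupp (f q) := fun q => minSupp_le_maxSupp (hv (q, false))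
  have hg : ∀ q : F, minSupp (g q) ≤ maxSupp (g q) := fun q => minSupp_le_maxSupp (hv (q, true))
  have hlo : ∀ (q : F) b, minSupp (f q) ≤ minSupp (v (q, b)) := by
    rintro q (_ | _)
    · exact le_rfl
    · exact (hf q).trans (hfg q).le
  have hhi : ∀ (q : F) b, maxSupp (v (q, b)) ≤ maxSupp (g q) := by
    rintro q (_ | _)
    · exact (hfg q).le.trans (hg q)
    · exact le_rfl
  have hlt : ∀ (q q' : F) b b', q < q' → maxSupp (v (q, b)) < minSupp (v (q', b')) :=
    fun q q' b b' hq => (hhi q b).trans_lt ((h.lt_of_lt hq (hd q')).trans_le (hlo q' b'))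
  have hmem : ∀ p, v p ∈ normingSet P := by
    rintro ⟨q, _ | _⟩
    · exact h.mem_f q (hd q)
    · exact h.mem_g q (hd q)
  have hc : ∀ p, |((ε : ℤ) : ℝ) * c p| ≤ 1 := by
    rintro ⟨q, _ | _⟩ <;> rw [abs_mul, abs_sign, one_mul]
    · exact ha q q.2
    · exact hb q q.2
  refine Set.mem_smul_set.2 ⟨∑ p, ⇑((((ε : ℤ) : ℝ) * c p) • restrict E (v p)), ?_, ?_⟩
  · refine sum_mem_iterSums_of_family (n := 0) (v := v) hv ?_ ?_
      (fun p => coe_mem_dualBall (hmem p) hE (hc p)) fun p i hi => smul_restrict_ne_zero hi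
    · rintro ⟨q, b⟩ ⟨q', b'⟩ hne
      rcases lt_trichotomy q q' with hq | rfl | hq
      · exact .inl (hlt q q' b b' hq)
      · cases b <;> cases b'
        · exact absurd rfl hne
        · exact .inl (hfg q)
        · exact .inr (hfg q)
        · exact absurd rfl hne
      · exact .inr (hlt q' q b' b hq)
    · intro m hm
      obtain ⟨⟨q, b⟩, -, rfl⟩ := Finset.mem_image.1 hm
      have h1 : minSupp (f (F.min' hF)) ≤ minSupp (f q) := by
        rcases (F.min'_le q q.2).eq_or_lt with heq | hlt'
        · rw [heq]
        · exact (hlt ⟨_, F.min'_mem hF⟩ q false false hlt').le.trans' (hf ⟨_, F.min'_mem hF⟩)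
      calc _ ≤ Fintype.card (F × Bool) := Finset.card_image_le
        _ = 2 * F.card := by simp [mul_comm]
        _ ≤ (minSupp (f (F.min' hF)) : ℕ) := hcard
        _ ≤ _ := h1.trans (hlo q b)
  · rw [restrict_smul, restrict_sum, Fintype.sum_prod_type, ← Finset.sum_coe_sort F, pow_one]
    ext i
    simp only [v, c, Fintype.sum_bool, cond_true, cond_false, restrict_add, restrict_smul,
      Finsupp.coe_smul, Finsupp.finsetSum_apply, Finset.sum_apply, Pi.add_apply, Pi.smul_apply,
      Finsupp.add_apply, Finsupp.smul_apply, smul_eq_mul, Finset.mul_sum]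
    exact Finset.sum_congr rfl fun q _ => by ring

theorem mem_of_mem_generators {f : C00} (hf : f ∈ generators P) :
    (∃ i c, f = Finsupp.single i c) ∨ ∃ n, 1 ≤ n ∧ ⇑f ∈ (1 / (2 : ℝ) ^ n) • iterSums P n := by
  rcases hf.2 with h | ⟨n, h⟩ | ⟨n, h⟩ | ⟨S, h⟩
  · exact .inl h
  · exact .inr ⟨n, IsTypeI.mem_smul_iterSums (fun _ _ h => h.1) h⟩
  · exact .inr ⟨n, IsTypeI.mem_smul_iterSums (fun _ _ h => h.1) h⟩
  · refine .inr ⟨1, le_rfl, ?_⟩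
    rcases h with ⟨d, f, g, w, F, hF, E, ε, h1, h2, h3, h4, rfl, -⟩ |
      ⟨d, f, g, w, F, hF, c, E, ε, h1, h2, h3, h6, h4, rfl, -⟩
    · simpa using h1.mem_smul_iterSums hF h2 h3 h4 (a := fun _ => 1) (b := fun _ => 1)
        (by simp) (by simp) ε
    · have h8 : ∀ q, (c q : ℝ) • (f q - g q) = (c q : ℝ) • f q + (-(c q : ℝ)) • g q := fun q => by
        rw [smul_sub, neg_smul, sub_eq_add_neg]
      simp only [h8]
      exact h1.mem_smul_iterSums hF h2 h3 h4 (a := fun q => (c q : ℝ))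
        (b := fun q => -(c q : ℝ)) (fun q hq => h6.abs_le P.norm_x hq)
        (fun q hq => by simpa using h6.abs_le P.norm_x hq) ε

/-- The generators, seen as scalar sequences. -/
def generatorSeqs (P : Choices) : Set (ℕ+ → ℝ) := (fun f : C00 => ⇑f) '' generators P

theorem closure_generatorSeqs_subset (P : Choices) : closure (generatorSeqs P) ⊆ dualBall P := by
  refine closure_minimal ?_ (isClosed_dualBall P)
  rintro _ ⟨f, hf, rfl⟩
  exact mem_dualBall_of_mem hf.1

theorem tailLE_closure_generatorSeqs (hθ : 0 ≤ θ) (h : ∀ g ∈ dualBall P, TailLE P θ g) :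
    ∀ g ∈ closure (generatorSeqs P), TailLE P (θ / 2) g := by
  intro g hg
  by_cases h0 : ∃ i j, i ≠ j ∧ g i ≠ 0 ∧ g j ≠ 0
  · obtain ⟨i, j, hij, hi, hj⟩ := h0
    obtain ⟨N, hN⟩ := exists_pow_lt_of_lt_one (abs_pos.2 hi) (one_half_lt_one (α := ℝ))
    -- Near g, the nonzero coordinate j together with i excludes multiples of unit vectors, and |f
    -- i| > 2⁻ᴺ bounds the weight by N, since a generator of weight n has coordinates at most 2⁻ⁿ.
    have hopen : IsOpen {f : ℕ+ → ℝ | f j ≠ 0 ∧ (1 / 2 : ℝ) ^ N < |f i|} :=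
      (isOpen_ne_fun (continuous_apply j) continuous_const).inter
        (isOpen_lt continuous_const (continuous_apply i).abs)
    have h1 : g ∈ closure (⋃ n ∈ Finset.Icc 1 N, (1 / (2 : ℝ) ^ n) • iterSums P n) := by
      refine closure_mono ?_ (hopen.inter_closure ⟨⟨hj, hN⟩, hg⟩)
      rintro _ ⟨⟨hfj, hfi⟩, f, hf, rfl⟩
      have hfi0 : f i ≠ 0 := abs_pos.1 (lt_trans (by positivity) hfi)
      rcases mem_of_mem_generators hf with ⟨k, c, rfl⟩ | ⟨n, hn, hfn⟩
      · exfalso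
        rcases eq_or_ne k i with rfl | hki
        · exact hfj (by simp [hij])
        · exact hfi0 (by simp [hki])
      · refine Set.mem_biUnion (Finset.mem_coe.2 (Finset.mem_Icc.2 ⟨hn, ?_⟩)) hfn
        obtain ⟨u, hu, hfu⟩ := Set.mem_smul_set.1 hfn
        have h2 : |f i| ≤ (1 / 2 : ℝ) ^ n := by
          have h3 : f i = (1 / (2 : ℝ) ^ n) * u i := by
            rw [← hfu]
            rfl
          rw [h3, abs_mul, one_div_pow, abs_of_pos (by positivity)]
          exact mul_le_of_le_one_right (by positivity) (mem_box.1 (iterSums_subset_box P n hu) i)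
        exact ((pow_lt_pow_iff_right_of_lt_one₀ (by norm_num) (by norm_num)).1
          (lt_of_lt_of_le hfi h2)).le
    rw [Finset.closure_biUnion] at h1
    obtain ⟨n, hn, hgn⟩ := Set.mem_iUnion₂.1 h1
    rw [closure_smul₀] at hgn
    obtain ⟨u, hu, rfl⟩ := Set.mem_smul_set.1 hgn
    -- The gain: 2⁻ⁿθ ≤ θ/2 because n ≥ 1.
    refine ((tailLE_closure_iterSums hθ h n u hu).smul (c := 1 / (2 : ℝ) ^ n)
      (by positivity)).mono ?_
    rw [div_eq_mul_one_div θ 2, mul_comm]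
    refine mul_le_mul_of_nonneg_left (one_div_le_one_div_of_le (by norm_num) ?_) hθ
    exact le_self_pow₀ (by norm_num) (by have := (Finset.mem_Icc.1 hn).1; omega)
  · push Not at h0
    by_cases h1 : ∀ i, g i = 0
    · exact TailLE.of_eventually_zero (N := 1) (by positivity) fun i _ => h1 i
    · push Not at h1
      obtain ⟨i, hi⟩ := h1
      exact TailLE.of_eventually_zero (N := i) (by positivity) fun j hj => h0 i j hj.ne hi

/-! ### From the closure of the generators to the whole dual ball -/

theorem norm_le_of_generators {x : PreX P} {C : ℝ}
    (h : ∀ f ∈ generators P, pairing f (toC00 P x) ≤ C) : ‖x‖ ≤ C := by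
  refine norm_le_of_forall fun f hf => ?_
  have hconv : Convex ℝ {f : C00 | pairing f (toC00 P x) ≤ C} := by
    refine convex_halfSpace_le ⟨fun f g => ?_, fun c f => ?_⟩ C
    · simp only [← act_coe, Finsupp.coe_add, act_add_left]
    · simp only [← act_coe, Finsupp.coe_smul, act_smul_left, smul_eq_mul]
  exact convexHull_min h hconv (normingSet_subset_convexHull P hf)

theorem tailLE_dualBall_of_closure {c : ℝ} (hc : 0 ≤ c)
    (h : ∀ g ∈ closure (generatorSeqs P), TailLE P c g) : ∀ g ∈ dualBall P, TailLE P c g := by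
  intro f hf
  by_contra hcon
  unfold TailLE at hcon
  push Not at hcon
  obtain ⟨δ, hδ, hbad⟩ := hcon
  -- Normalise the bad vectors and fix their signs, so that convex combinations keep the lower bound
  -- c + δ for f.
  have hy : ∀ n : ℕ, ∃ y : PreX P, (∀ i ≤ n.succPNat, toC00 P y i = 0) ∧ ‖y‖ ≤ 1 ∧
      c + δ ≤ act f (toC00 P y) := by
    intro n
    obtain ⟨x, hx0, hx⟩ := hbad n.succPNat
    have hxpos : 0 < ‖x‖ := by
      have h1 := (mul_nonneg (by positivity) (norm_nonneg x)).trans_lt (hx.trans_le (hf x))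
      exact h1
    set t := SignType.sign (act f (toC00 P x)) with ht
    refine ⟨((t : ℝ) / ‖x‖) • x, fun i hi => by simp [hx0 i hi], ?_, ?_⟩
    · rw [norm_smul, norm_div, norm_norm, div_mul_cancel₀ _ hxpos.ne']
      rcases t with _ | _ | _ <;> simp
    · rw [map_smul, act_smul_right, div_mul_eq_mul_div, ht, sign_mul_self, le_div_iff₀ hxpos]
      exact hx.le
  choose y hy0 hy1 hy2 using hy
  set K := closure (generatorSeqs P) with hK
  have hKc : IsCompact K := isCompact_box.of_isClosed_subset isClosed_closure
    ((closure_generatorSeqs_subset P).trans (dualBall_subset_box P))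
  have : CompactSpace K := isCompact_iff_compactSpace.1 hKc
  -- The excess of |g(yₙ)| over c: bounded by 1 and tending to 0 at each g in K by the assumption on
  -- K.
  let φ : ℕ → C(K, ℝ) := fun n => ⟨fun g => max (|act g (toC00 P (y n))| - c) 0, by
    have := (continuous_act (toC00 P (y n))).comp (continuous_subtype_val (p := (· ∈ K)))
    exact (this.abs.sub continuous_const).max continuous_const⟩
  obtain ⟨ψ, hψ, hψlt⟩ := exists_mem_convexHull_lt φ 1 (fun n g => by
      have h1 : |act g (toC00 P (y n))| ≤ 1 :=
        (closure_generatorSeqs_subset P g.2 (y n)).trans (hy1 n)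
      rw [abs_of_nonneg (le_max_right _ _)]
      exact max_le (by linarith) zero_le_one)
    (fun g => by
      rw [Metric.tendsto_atTop]
      intro η hη
      obtain ⟨N, hN⟩ := h g g.2 (η / 2) (by positivity)
      refine ⟨N, fun n hn => ?_⟩
      have h1 := hN (y n) fun i hi => hy0 n i (hi.trans (by
        rw [← PNat.coe_le_coe, Nat.succPNat_coe]; omega))
      have h2 : (c + η / 2) * ‖y n‖ ≤ c + η / 2 :=
        mul_le_of_le_one_right (by positivity) (hy1 n)
      rw [Real.dist_eq, sub_zero, abs_of_nonneg (le_max_right _ _)]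
      exact max_lt (by linarith) hη) (half_pos hδ)
  -- A convex combination of the φ n is matched by the same combination z of the yₙ, whose values on
  -- K exceed c by at most ψ.
  have hT : convexHull ℝ (Set.range φ) ⊆ {ψ : C(K, ℝ) | ∃ z : PreX P, c + δ ≤ act f (toC00 P z) ∧
      ∀ g : K, |act g (toC00 P z)| ≤ c + ψ g} := by
    refine convexHull_min ?_ ?_
    · rintro _ ⟨n, rfl⟩
      refine ⟨y n, hy2 n, fun g => ?_⟩
      have h1 : |act g (toC00 P (y n))| - c ≤ φ n g := le_max_left _ _
      linarith
    · rintro ψ₁ ⟨z₁, h1, h1'⟩ ψ₂ ⟨z₂, h2, h2'⟩ a b ha hb hab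
      refine ⟨a • z₁ + b • z₂, ?_, fun g => ?_⟩
      · rw [map_add, map_smul, map_smul, act_add_right, act_smul_right, act_smul_right]
        calc c + δ = a * (c + δ) + b * (c + δ) := by rw [← add_mul, hab, one_mul]
          _ ≤ _ := by gcongr
      · rw [map_add, map_smul, map_smul, act_add_right, act_smul_right, act_smul_right]
        calc _ ≤ a * |act g (toC00 P z₁)| + b * |act g (toC00 P z₂)| := by
              refine (abs_add_le _ _).trans_eq ?_
              rw [abs_mul, abs_mul, abs_of_nonneg ha, abs_of_nonneg hb]
          _ ≤ a * (c + ψ₁ g) + b * (c + ψ₂ g) := by gcongr; exacts [h1' g, h2' g]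
          _ = (a + b) * c + (a * ψ₁ g + b * ψ₂ g) := by ring
          _ = c + (a • ψ₁ + b • ψ₂) g := by simp [hab]
  obtain ⟨z, hz1, hz2⟩ := hT hψ
  have hz : ‖z‖ ≤ c + δ / 2 := norm_le_of_generators fun k hk =>
    (le_abs_self _).trans ((hz2 ⟨k, subset_closure ⟨k, hk, rfl⟩⟩).trans
      (add_le_add_right (hψlt _).le c))
  have := (le_abs_self _).trans (hf z)
  linarith

/-- The bound 1 holds trivially for the dual ball, and each round of the bootstrap halves it. -/
theorem tailLE_dualBall (P : Choices) (n : ℕ) : ∀ g ∈ dualBall P, TailLE P ((1 / 2) ^ n) g := by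
  induction n with
  | zero =>
    intro g hg δ hδ
    refine ⟨1, fun x _ => (hg x).trans (le_mul_of_one_le_left (norm_nonneg x) ?_)⟩
    rw [pow_zero]
    linarith
  | succ n ih =>
    rw [pow_succ, mul_one_div]
    exact tailLE_dualBall_of_closure (by positivity)
      (tailLE_closure_generatorSeqs (by positivity) ih)

theorem exists_forall_abs_act_le {g : ℕ+ → ℝ} (hg : g ∈ dualBall P) {ε : ℝ} (hε : 0 < ε) :
    ∃ N : ℕ+, ∀ x : PreX P, (∀ i ≤ N, toC00 P x i = 0) → |act g (toC00 P x)| ≤ ε * ‖x‖ := by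
  obtain ⟨n, hn⟩ := exists_pow_lt_of_lt_one (half_pos hε) (one_half_lt_one (α := ℝ))
  obtain ⟨N, hN⟩ := tailLE_dualBall P n g hg (ε / 2) (half_pos hε)
  refine ⟨N, fun x hx => (hN x hx).trans ?_⟩
  have : (1 / 2 : ℝ) ^ n + ε / 2 ≤ ε := by linarith
  gcongr

/-! ### The unit vector basis -/

/-- The vector `∑_{i < n} aᵢ e_{i+1}` of `c₀₀`. -/
def partialSum (P : Choices) (a : ℕ → ℝ) (n : ℕ) : PreX P :=
  ∑ i ∈ Finset.range n, a i • (toC00 P).symm (Finsupp.single i.succPNat 1)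

theorem partialSum_apply (P : Choices) (a : ℕ → ℝ) (n : ℕ) (j : ℕ+) :
    toC00 P (partialSum P a n) j = if (j : ℕ) ≤ n then a j.natPred else 0 := by
  classical
  simp only [partialSum, map_sum, map_smul, LinearEquiv.apply_symm_apply, Finsupp.finsetSum_apply,
    Finsupp.smul_apply, smul_eq_mul]
  split_ifs with h
  · rw [Finset.sum_eq_single_of_mem j.natPred]
    · simp
    · rw [Finset.mem_range, ← PNat.natPred_add_one j] at *
      omega
    · intro i _ hi
      rw [Finsupp.single_apply, if_neg, mul_zero]
      rintro rfl
      simp at hi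
  · refine Finset.sum_eq_zero fun i hi => ?_
    rw [Finsupp.single_apply, if_neg, mul_zero]
    rintro rfl
    rw [Finset.mem_range] at hi
    rw [Nat.succPNat_coe] at h
    omega

theorem coe_partialSum (P : Choices) (a : ℕ → ℝ) (n : ℕ) :
    ((partialSum P a n : PreX P) : X P) = ∑ i ∈ Finset.range n, a i • e P i.succPNat := by
  have h : ∀ x : PreX P, (x : X P) = UniformSpace.Completion.toComplL (𝕜 := ℝ) x := fun _ => rfl
  rw [partialSum, h, map_sum]
  refine Finset.sum_congr rfl fun i _ => ?_
  rw [map_smul]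
  rfl

theorem pairing_restrict_comm (E : Set ℕ+) (f x : C00) :
    pairing f (restrict E x) = pairing (restrict E f) x := by
  classical
  have h : ∀ f x : C00, ∀ s : Finset ℕ+, x.support ⊆ s → pairing f x = ∑ i ∈ s, f i * x i :=
    fun f x s hs => Finsupp.sum_of_support_subset _ hs _ (by simp)
  rw [h f (restrict E x) x.support, h _ x x.support subset_rfl]
  · refine Finset.sum_congr rfl fun i _ => ?_
    rw [restrict_apply, restrict_apply]
    split_ifs <;> simp
  · intro i hi
    rw [Finsupp.mem_support_iff] at hi ⊢
    intro h0
    rw [restrict_apply, h0] at hi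
    simp at hi

/-- An interval restriction can be moved onto the functional, and W is closed under it. -/
theorem norm_restrict_le (x : PreX P) {E : Set ℕ+} (hE : E.OrdConnected) :
    ‖((toC00 P).symm (restrict E (toC00 P x)) : PreX P)‖ ≤ ‖x‖ := by
  refine norm_le_of_forall fun f hf => ?_
  rw [LinearEquiv.apply_symm_apply, pairing_restrict_comm]
  exact pairing_le_norm ((normingSet_isNormingClosed P).restrict f hf E hE) x

/-- The `i`-th coordinate functional on `c₀₀`. -/
def preCoord (P : Choices) (i : ℕ+) : StrongDual ℝ (PreX P) :=
  LinearMap.mkContinuous ((Finsupp.lapply i).comp (toC00 P).toLinearMap) 1 fun x => by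
    rw [one_mul]
    refine le_trans (le_of_eq ?_)
      (abs_pairing_le_norm ((normingSet_isNormingClosed P).basis i).1 x)
    rw [pairing_single]
    rfl

/-- The `i`-th coordinate functional on `𝔛`. -/
def coord (P : Choices) (i : ℕ+) : StrongDual ℝ (X P) :=
  (preCoord P i).extend UniformSpace.Completion.toComplL

theorem coord_coe (P : Choices) (i : ℕ+) (x : PreX P) : coord P i (x : X P) = toC00 P x i :=
  ContinuousLinearMap.extend_eq (preCoord P i) UniformSpace.Completion.denseRange_coe
    (UniformSpace.Completion.isUniformInducing_coe _) x

/-- The canonical projection of `𝔛` onto the span of the first `n` unit vectors. -/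
def basisProj (P : Choices) (n : ℕ) : X P →L[ℝ] X P :=
  ∑ i ∈ Finset.range n, (coord P i.succPNat).smulRight (e P i.succPNat)

theorem basisProj_apply (n : ℕ) (x : X P) :
    basisProj P n x = ∑ i ∈ Finset.range n, coord P i.succPNat x • e P i.succPNat := by
  simp [basisProj]

/-- The case n = 0 is separate because `Nat.toPNat'` sends 0 to 1, which would keep the first
coordinate. -/
theorem basisProj_coe (n : ℕ) (x : PreX P) : basisProj P n (x : X P) =
    (((toC00 P).symm (restrict (Set.Iic n.toPNat') (toC00 P x)) : PreX P) : X P) ∨ n = 0 := by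
  classical
  rcases Nat.eq_zero_or_pos n with rfl | hn
  · exact .inr rfl
  left
  have h : (toC00 P).symm (restrict (Set.Iic n.toPNat') (toC00 P x)) =
      partialSum P (fun i => toC00 P x i.succPNat) n := by
    rw [LinearEquiv.symm_apply_eq]
    ext j
    rw [partialSum_apply, restrict_apply, PNat.succPNat_natPred]
    simp only [Set.mem_Iic, ← PNat.coe_le_coe, Nat.toPNat'_coe, if_pos hn]
  rw [h, coe_partialSum, basisProj_apply]
  simp only [coord_coe]

theorem norm_basisProj_le (n : ℕ) (x : X P) : ‖basisProj P n x‖ ≤ ‖x‖ := by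
  induction x using UniformSpace.Completion.induction_on with
  | hp => exact isClosed_le (basisProj P n).continuous.norm continuous_norm
  | ih x =>
    rcases basisProj_coe n x with h | rfl
    · rw [h, UniformSpace.Completion.norm_coe, UniformSpace.Completion.norm_coe]
      exact norm_restrict_le x Set.ordConnected_Iic
    · simp [basisProj]

theorem eventually_basisProj_coe (x : PreX P) :
    ∀ᶠ n in atTop, basisProj P n (x : X P) = (x : X P) := by
  classical
  obtain ⟨M, hM⟩ := (toC00 P x).support.bddAbove
  filter_upwards [eventually_ge_atTop (M : ℕ)] with n hn
  rcases basisProj_coe n x with h | rfl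
  · rw [h]
    congr 1
    rw [LinearEquiv.symm_apply_eq]
    ext j
    rw [restrict_apply]
    split_ifs with hj
    · rfl
    · by_contra hne
      have h1 : j ≤ M := hM (Finsupp.mem_support_iff.2 (Ne.symm hne))
      refine hj (h1.trans ?_)
      rw [← PNat.coe_le_coe, Nat.toPNat'_coe, if_pos (M.pos.trans_le hn)]
      exact hn
  · exact absurd hn (not_le.2 M.pos)

theorem tendsto_basisProj (x : X P) : Tendsto (fun n => basisProj P n x) atTop (𝓝 x) := by
  rw [Metric.tendsto_atTop]
  intro ε hε
  obtain ⟨y, hy⟩ := UniformSpace.Completion.denseRange_coe.exists_dist_lt x (half_pos hε)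
  obtain ⟨N, hN⟩ := eventually_atTop.1 (eventually_basisProj_coe y)
  refine ⟨N, fun n hn => ?_⟩
  calc dist (basisProj P n x) x ≤ dist (basisProj P n x) (basisProj P n y) +
        dist (basisProj P n y) x := dist_triangle _ _ _
    _ ≤ dist x y + dist (y : X P) x := by
      refine add_le_add ?_ (by rw [hN n hn])
      rw [dist_eq_norm, ← map_sub, dist_eq_norm]
      exact norm_basisProj_le n _
    _ < ε := by rw [dist_comm (y : X P) x]; linarith

/-- The unit vectors as a Schauder basis of `𝔛`. -/
def unitBasis (P : Choices) : SchauderBasis ℝ (X P) where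
  basis n := e P n.succPNat
  coord n := coord P n.succPNat
  ortho i j := by
    rw [e, coord_coe, LinearEquiv.apply_symm_apply]
    rcases eq_or_ne i j with rfl | h
    · simp
    · simp [Pi.single, Function.update, h]
  expansion x := by
    rw [HasSum, SummationFilter.conditional_filter_eq_map_range, tendsto_map'_iff]
    exact (tendsto_basisProj x).congr fun n => basisProj_apply n x

theorem unitBasis_apply (P : Choices) (n : ℕ) : unitBasis P n = e P n.succPNat := rfl

/-! ### The basis is shrinking -/

theorem eq_act (f : StrongDual ℝ (X P)) (x : PreX P) :
    f (x : X P) = act (fun i => f (e P i)) (toC00 P x) := by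
  have h : x = (toC00 P x).sum fun i t => t • (toC00 P).symm (Finsupp.single i 1) := by
    conv_lhs => rw [← (toC00 P).symm_apply_apply x, ← (toC00 P x).sum_single]
    rw [Finsupp.sum, map_sum]
    refine Finset.sum_congr rfl fun i _ => ?_
    rw [LinearEquiv.symm_apply_eq, map_smul, LinearEquiv.apply_symm_apply]
    simp
  have h2 : (x : X P) = (toC00 P x).sum fun i t => t • e P i := by
    conv_lhs => rw [h]
    change UniformSpace.Completion.toComplL (𝕜 := ℝ) _ = _
    rw [Finsupp.sum, map_sum]
    refine Finset.sum_congr rfl fun i _ => ?_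
    rw [map_smul]
    rfl
  rw [h2, Finsupp.sum, map_sum]
  refine Finset.sum_congr rfl fun i _ => ?_
  rw [map_smul, smul_eq_mul, mul_comm]

theorem exists_forall_abs_le (f : StrongDual ℝ (X P)) {ε : ℝ} (hε : 0 < ε) :
    ∃ N : ℕ+, ∀ x : PreX P, (∀ i ≤ N, toC00 P x i = 0) → |f (x : X P)| ≤ ε * ‖x‖ := by
  have hc : 0 < ‖f‖ + 1 := by positivity
  -- Scaling by ‖f‖ + 1 instead of ‖f‖ also covers f = 0.
  have hg : (‖f‖ + 1)⁻¹ • (fun i => f (e P i)) ∈ dualBall P := by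
    intro x
    rw [act_smul_left, ← eq_act, abs_mul, abs_of_pos (inv_pos.2 hc), inv_mul_le_iff₀ hc]
    refine (f.le_opNorm _).trans ?_
    rw [UniformSpace.Completion.norm_coe]
    gcongr
    linarith
  obtain ⟨N, hN⟩ := exists_forall_abs_act_le hg (ε := (‖f‖ + 1)⁻¹ * ε) (by positivity)
  refine ⟨N, fun x hx => ?_⟩
  have h := hN x hx
  rw [act_smul_left, ← eq_act, abs_mul, abs_of_pos (inv_pos.2 hc), mul_assoc] at h
  exact le_of_mul_le_mul_left h (inv_pos.2 hc)

/-- The basis vector of index k is e_{k+1}, so indices from n on leave the coordinates 1, …, n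
empty. -/
theorem exists_coe_of_mem_span {n : ℕ} {y : X P}
    (hy : y ∈ Submodule.span ℝ (unitBasis P '' Set.Ici n)) :
    ∃ x : PreX P, (x : X P) = y ∧ ∀ i : ℕ+, (i : ℕ) ≤ n → toC00 P x i = 0 := by
  classical
  induction hy using Submodule.span_induction with
  | mem y hy =>
    obtain ⟨k, hk, rfl⟩ := hy
    refine ⟨(toC00 P).symm (Finsupp.single k.succPNat 1), rfl, fun i hi => ?_⟩
    rw [LinearEquiv.apply_symm_apply, Finsupp.single_apply, if_neg]
    rintro rfl
    rw [Nat.succPNat_coe] at hi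
    exact absurd hk (not_le.2 (Nat.lt_of_succ_le hi))
  | zero => exact ⟨0, rfl, fun i _ => by simp⟩
  | add y z _ _ hy hz =>
    obtain ⟨x, rfl, hx⟩ := hy
    obtain ⟨x', rfl, hx'⟩ := hz
    exact ⟨x + x', UniformSpace.Completion.coe_add _ _, fun i hi => by simp [hx i hi, hx' i hi]⟩
  | smul c y _ hy =>
    obtain ⟨x, rfl, hx⟩ := hy
    exact ⟨c • x, UniformSpace.Completion.coe_smul _ _, fun i hi => by simp [hx i hi]⟩

theorem isShrinking_unitBasis (P : Choices) : IsShrinking (unitBasis P) := by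
  intro f
  rw [Metric.tendsto_atTop]
  intro ε hε
  obtain ⟨N, hN⟩ := exists_forall_abs_le f (half_pos hε)
  refine ⟨N, fun n hn => ?_⟩
  rw [dist_zero_right]
  refine lt_of_le_of_lt ((Real.norm_of_nonneg (ContinuousLinearMap.opNorm_nonneg _)).trans_le
    (ContinuousLinearMap.opNorm_le_bound _ (half_pos hε).le ?_))
    (half_lt_self hε)
  rintro ⟨y, hy⟩
  have h1 : IsClosed {y : X P | ‖f y‖ ≤ ε / 2 * ‖y‖} :=
    isClosed_le f.continuous.norm (continuous_const.mul continuous_norm)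
  refine closure_minimal (fun z hz => ?_) h1 hy
  obtain ⟨x, rfl, hx⟩ := exists_coe_of_mem_span hz
  rw [Set.mem_ofPred_eq, UniformSpace.Completion.norm_coe]
  exact hN x fun i hi => hx i ((PNat.coe_le_coe i N).2 hi |>.trans hn)

/-! ### The basis is boundedly complete -/

theorem lt_minSupp {f : C00} (hf : f ≠ 0) {N : ℕ+} (h : ∀ i ≤ N, f i = 0) : N < minSupp f := by
  have hne : f.support.Nonempty := Finsupp.support_nonempty_iff.2 hf
  unfold minSupp
  rw [dif_pos hne]
  by_contra! hle
  exact Finsupp.mem_support_iff.1 (f.support.min'_mem hne) (h _ hle)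

theorem eq_zero_of_le_of_lt_minSupp {f : C00} {N i : ℕ+} (hN : N < minSupp f) (hi : i ≤ N) :
    f i = 0 := by
  by_contra h
  exact absurd ((le_of_mem_support h).1.trans hi) (not_le.2 hN)

/-- From vectors supported arbitrarily far out with arbitrarily large sizes one can select very fast
growing sequences. -/
theorem exists_veryFastGrowing {Q : ℕ → C00 → Prop}
    (hQ : ∀ (N : ℕ+) (m : ℕ), ∃ s f, m < s ∧ Q s f ∧ f ≠ 0 ∧ N < minSupp f) (N : ℕ+) :
    ∃ (f : ℕ → C00) (s : ℕ → ℕ), (∀ k, Q (s k) (f k)) ∧ (∀ k, N < minSupp (f k)) ∧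
      (∀ d : ℕ, Successive fun k : Fin d => f k) ∧
      ∀ d : ℕ, VeryFastGrowing (fun k : Fin d => f k) fun k : Fin d => s k := by
  choose s f hs hf hf0 hmin using hQ
  -- The recursion state holds the last maximum of the support and the bound 2^max + s that the next
  -- size must exceed; this yields both growth conditions at once.
  let a : ℕ → ℕ+ × ℕ := fun k => k.rec (N, 0) fun _ p =>
    (maxSupp (f p.1 p.2), 2 ^ (maxSupp (f p.1 p.2) : ℕ) + s p.1 p.2)
  have ha : ∀ k, a (k + 1) = (maxSupp (f (a k).1 (a k).2),
    2 ^ (maxSupp (f (a k).1 (a k).2) : ℕ) + s (a k).1 (a k).2) := fun _ => rfl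
  let g : ℕ → C00 := fun k => f (a k).1 (a k).2
  let t : ℕ → ℕ := fun k => s (a k).1 (a k).2
  have hg0 : ∀ k, g k ≠ 0 := fun k => hf0 _ _
  have hstep : ∀ k, maxSupp (g k) < minSupp (g (k + 1)) := fun k => by
    have h := hmin (a (k + 1)).1 (a (k + 1)).2
    exact h
  have hmono : ∀ i j, i < j → maxSupp (g i) < minSupp (g j) := by
    intro i j hij
    induction j, hij using Nat.le_induction with
    | base => exact hstep i
    | succ j _ ih => exact (ih.trans_le (minSupp_le_maxSupp (hg0 j))).trans (hstep j)
  have hsucc : ∀ d : ℕ, Successive fun k : Fin d => g k := fun d =>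
    ⟨fun k => hg0 k, fun i j hij => ⟨hg0 i, hg0 j, hmono i j hij⟩⟩
  refine ⟨g, t, fun k => hf _ _, fun k => ?_, hsucc, fun d => ⟨hsucc d, fun i j hij => ?_⟩⟩
  · rcases Nat.eq_zero_or_pos k with rfl | hk
    · exact hmin N 0
    · exact (hmin N 0).trans ((minSupp_le_maxSupp (hg0 0)).trans_lt (hmono 0 k hk))
  · have h : 2 ^ (maxSupp (g i) : ℕ) + t i < t (i + 1) := by
      have h1 := hs (a (i + 1)).1 (a (i + 1)).2
      exact h1
    have hij' : t j = t (i + 1) := by rw [hij]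
    have h2 : 0 < 2 ^ (maxSupp (g i) : ℕ) := by positivity
    change 2 ^ (maxSupp (g i) : ℕ) < t j ∧ t i < t j
    omega

theorem act_sum_right (A : ℕ+ → ℝ) {ι : Type*} (s : Finset ι) (f : ι → C00) :
    act A (∑ i ∈ s, f i) = ∑ i ∈ s, act A (f i) := by
  classical
  induction s using Finset.induction_on with
  | empty => simp [act]
  | insert i s hi ih => rw [Finset.sum_insert hi, Finset.sum_insert hi, act_add_right, ih]

theorem exists_lt_act {A : ℕ+ → ℝ} {η : ℝ} (hη : 0 < η)
    (h : ∀ N : ℕ+, ∃ f ∈ normingSet P, (∀ i ≤ N, f i = 0) ∧ η ≤ act A f) (M : ℝ) :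
    ∃ f ∈ normingSet P, M < act A f := by
  have hW := normingSet_isNormingClosed P
  have hne : ∀ f : C00, η ≤ act A f → f ≠ 0 := by
    rintro f hf rfl
    simp [act] at hf
    linarith
  have havg : ∀ (N : ℕ+) (m : ℕ), ∃ s f, m < s ∧
      (IsAlphaAverage (normingSet P) s f ∧ η ≤ act A f) ∧ f ≠ 0 ∧ N < minSupp f := by
    intro N m
    -- Only successive functionals are needed here, so the property ignores the size and the size m
    -- + 1 is a dummy.
    obtain ⟨f, -, h1, h2, h3, -⟩ := exists_veryFastGrowing
      (Q := fun _ f => f ∈ normingSet P ∧ η ≤ act A f) (fun N m => by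
        obtain ⟨f, h1, h2, h3⟩ := h N
        exact ⟨m + 1, f, m.lt_succ_self, ⟨h1, h3⟩, hne f h3, lt_minSupp (hne f h3) h2⟩) N
    have hpos : (0 : ℝ) < ((m + 1 : ℕ) : ℝ) := by positivity
    have hα : η ≤ act A ((1 / ((m + 1 : ℕ) : ℝ)) • ∑ k : Fin (m + 1), f k) := by
      rw [act_smul_right, act_sum_right, one_div, le_inv_mul_iff₀ hpos]
      calc ((m + 1 : ℕ) : ℝ) * η = ∑ _k : Fin (m + 1), η := by simp
        _ ≤ _ := Finset.sum_le_sum fun k _ => (h1 k).2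
    refine ⟨m + 1, (1 / ((m + 1 : ℕ) : ℝ)) • ∑ k : Fin (m + 1), f k, m.lt_succ_self,
      ⟨⟨?_, by omega, m + 1, fun k => f k, le_rfl, fun k => (h1 k).1, h3 _, rfl⟩, hα⟩, hne _ hα,
      lt_minSupp (hne _ hα) fun i hi => ?_⟩
    · have h4 := hW.convex (m + 1) (fun _ => 1 / ((m + 1 : ℕ) : ℚ)) (fun k => f k)
        (fun _ => by positivity) (by
          rw [Finset.sum_const, Finset.card_univ, Fintype.card_fin, nsmul_eq_mul]
          field_simp) fun k => (h1 k).1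
      rw [Finset.smul_sum]
      simpa using h4
    · rw [Finsupp.smul_apply, Finsupp.finsetSum_apply, Finset.sum_eq_zero, smul_zero]
      exact fun k _ => eq_zero_of_le_of_lt_minSupp (h2 k) hi
  -- With d averages each of value at least η, weight 1 gives at least dη/2 > M. Starting the
  -- averages after d + 1 makes the d of them 𝒮₁-admissible.
  obtain ⟨d, hd⟩ := exists_nat_gt (M / (η / 2))
  obtain ⟨f, s, h1, h2, h3, h4⟩ := exists_veryFastGrowing havg d.succPNat
  refine ⟨((1 : ℤˣ) : ℝ) • restrict Set.univ ((1 / (2 : ℝ) ^ 1) • ∑ k : Fin d, f k),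
    hW.alpha 1 _ ⟨le_rfl, d, fun k => f k, fun k => s k, Set.univ, 1, fun k => (h1 k).1,
      ⟨h3 d, ?_⟩, h4 d, Set.ordConnected_univ, by simp⟩, ?_⟩
  · intro m hm
    obtain ⟨k, -, rfl⟩ := Finset.mem_image.1 hm
    refine Finset.card_image_le.trans ?_
    rw [Finset.card_univ, Fintype.card_fin]
    have h5 := PNat.coe_lt_coe _ _ |>.2 (h2 k)
    rw [Nat.succPNat_coe] at h5
    exact (Nat.le_succ d).trans h5.le
  · have h5 : ∀ u : C00, restrict Set.univ u = u := fun u => by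
      classical
      ext i
      simp [restrict_apply]
    have h6 : d * η ≤ ∑ k : Fin d, act A (f k) := by
      calc d * η = ∑ _k : Fin d, η := by simp
        _ ≤ _ := Finset.sum_le_sum fun k _ => (h1 k).2
    rw [h5, act_smul_right, act_smul_right, act_sum_right]
    rw [div_lt_iff₀ (by positivity)] at hd
    simp only [Units.val_one, Int.cast_one, one_mul, pow_one]
    linarith

/-- Exchanges the roles of functional and vector: f is tested against the whole coefficient
sequence, which need not come from a vector of the space. -/
theorem pairing_partialSum {a : ℕ → ℝ} {f : C00} {n : ℕ} (hf : ∀ i, f i ≠ 0 → (i : ℕ) ≤ n) :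
    pairing f (toC00 P (partialSum P a n)) = act (fun i => a i.natPred) f := by
  classical
  have h1 : pairing f (toC00 P (partialSum P a n)) =
      ∑ i ∈ f.support, f i * toC00 P (partialSum P a n) i := by
    unfold pairing Finsupp.sum
    refine Finset.sum_congr_of_eq_on_inter (fun i _ h => ?_) (fun i _ h => ?_) fun _ _ _ => rfl
    · simp [Finsupp.notMem_support_iff.1 h]
    · simp [Finsupp.notMem_support_iff.1 h]
  rw [h1]
  refine Finset.sum_congr rfl fun i hi => ?_
  rw [partialSum_apply, if_pos (hf i (Finsupp.mem_support_iff.1 hi)), mul_comm]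

theorem isBoundedlyComplete_unitBasis (P : Choices) : IsBoundedlyComplete (unitBasis P) := by
  classical
  rintro a ⟨M, hM⟩
  have hM' : ∀ n, ‖partialSum P a n‖ ≤ M := fun n => by
    have h := hM n
    simp only [unitBasis_apply] at h
    rwa [← coe_partialSum, UniformSpace.Completion.norm_coe] at h
  apply cauchySeq_tendsto_of_complete
  simp only [unitBasis_apply, ← coe_partialSum]
  by_contra hcon
  rw [Metric.cauchySeq_iff'] at hcon
  push Not at hcon
  obtain ⟨δ, hδ, hbad⟩ := hcon
  obtain ⟨f, hf, hlt⟩ := exists_lt_act (P := P) (A := fun i => a i.natPred) (half_pos hδ)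
    (fun N => by
      obtain ⟨n, hn, hdist⟩ := hbad N
      rw [dist_eq_norm, ← UniformSpace.Completion.coe_sub, UniformSpace.Completion.norm_coe]
        at hdist
      obtain ⟨f, hf, hfδ⟩ : ∃ f ∈ normingSet P,
          δ / 2 < pairing f (toC00 P (partialSum P a n - partialSum P a N)) := by
        by_contra! hle
        have := norm_le_of_forall hle
        linarith
      have hnpos : 0 < n := N.pos.trans_le hn
      -- The difference is the restriction of one partial sum to (N, n]. Moving the restriction onto
      -- f gives a functional supported after N.
      have hE : (partialSum P a n - partialSum P a N) =
          (toC00 P).symm (restrict (Set.Ioc N n.toPNat') (toC00 P (partialSum P a n))) := by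
        rw [LinearEquiv.eq_symm_apply, map_sub]
        ext i
        rw [Finsupp.sub_apply, restrict_apply, partialSum_apply, partialSum_apply]
        simp only [Set.mem_Ioc, ← PNat.coe_le_coe, ← PNat.coe_lt_coe, Nat.toPNat'_coe, if_pos hnpos]
        by_cases h1 : (i : ℕ) ≤ N
        · rw [if_pos h1, if_pos (h1.trans hn), if_neg (by omega), sub_self]
        · rw [if_neg h1, sub_zero]
          by_cases h2 : (i : ℕ) ≤ n
          · rw [if_pos h2, if_pos (by omega)]
          · rw [if_neg h2, if_neg (by omega)]
      rw [hE, LinearEquiv.apply_symm_apply, pairing_restrict_comm, pairing_partialSum] at hfδ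
      · refine ⟨_, (normingSet_isNormingClosed P).restrict f hf (Set.Ioc N n.toPNat')
          Set.ordConnected_Ioc, fun i hi => ?_, hfδ.le⟩
        rw [restrict_apply, if_neg fun h => absurd h.1 (not_lt.2 hi)]
      · intro i hi
        rw [restrict_apply] at hi
        have h1 := PNat.coe_le_coe _ _ |>.2 (by_contra fun h => hi (if_neg h) :
          i ∈ Set.Ioc N n.toPNat').2
        rwa [Nat.toPNat'_coe, if_pos hnpos] at h1) M
  -- Cutting the coefficients at `maxSupp f` turns the large value into a value on a partial sum,
  -- whose norm is at most M.
  rw [← pairing_partialSum (P := P) (n := maxSupp f) fun i hi =>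
    PNat.coe_le_coe _ _ |>.2 (le_of_mem_support hi).2] at hlt
  exact absurd ((pairing_le_norm hf _).trans (hM' _)) (not_le.2 hlt)

end RichSpreading

end

theorem mainTheorem3 (P : RichSpreading.Choices) :
    ∃ b : SchauderBasis ℝ (RichSpreading.X P),
      (∀ n : ℕ, b n = RichSpreading.e P n.succPNat) ∧
      RichSpreading.IsShrinking b ∧
      RichSpreading.IsBoundedlyComplete b ∧
      RichSpreading.IsReflexive (RichSpreading.X P) := by
  exact ⟨RichSpreading.unitBasis P, RichSpreading.unitBasis_apply P,
    RichSpreading.isShrinking_unitBasis P, RichSpreading.isBoundedlyComplete_unitBasis P,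
    RichSpreading.isReflexive_of_basis (RichSpreading.isShrinking_unitBasis P)
      (RichSpreading.isBoundedlyComplete_unitBasis P)⟩
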